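/- Let $n\ge 2$ and $\tfrac12<s<1$. For $u:\mathbb R^n\to\mathbb R$ put $\delta(u,x,y)=u(x+y)+u(x-y)-2u(x)$ and, for a symmetric positive definite matrix $A$ (written $A>0$), $$L_Au(x)=\frac12\int_{\mathbb R^n}\frac{\delta(u,x,y)}{|A^{-1}y|^{n+2s}}\,dy\in[-\infty,+\infty],$$ $$\mathcal D_su(x)=\inf\{L_Au(x): A>0,\ \det A=1\},\qquad \mathcal D_s^\theta u(x)=\inf\{L_Au(x): A>0,\ \det A=1,\ \lambda_{\min}(A)\ge\theta\}.$$ Let $u:\mathbb R^n\to\mathbb R$ be Lipschitz with constant $L$ and semiconcave with constant $C\ge0$, that is, $\delta(u,x,y)\le C|y|^2$ for all $x,y\in\mathbb R^n$. Let $\Omega\subset\mathbb R^n$ be open and let $\eta_0>0$ be such that $(1-s)\mathcal D_su\ge\eta_0$ in $\Omega$ in the viscosity sense: whenever $x\in\Omega$, $N\subset\Omega$ is an open neighborhood of $x$, and $\psi$ is $C^2$ in $\overline N$ with $\psi(x)=u(x)$ and $\psi>u$ in $N\setminus\{x\}$, the function $v$ equal to $\psi$ in $N$ and to $u$ in $\mathbb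 R^n\setminus N$ satisfies $(1-s)\mathcal D_sv(x)\ge\eta_0$. With $\omega_k=2\pi^{k/2}/\Gamma(k/2)$, set $$\mu_1=\frac{1-s}{2}\int_{\mathbb R}\frac{\min\{2L|t|,\,C|t|^2\}}{|t|^{1+2s}}\,dt=\frac{L^{2-2s}}{2s-1}\Big(\frac C2\Big)^{2s-1},\qquad \mu_0=C_1^{1-n}C_2^{-1}\Big(\frac{\eta_0}{2}\Big)^n,$$ $$C_1=\frac{\sqrt\pi\,\Gamma(\frac{n-1}2+s)}{\Gamma(\frac n2+s)}\cdot\frac{\mu_1\omega_{n-1}}2,\qquad C_2=\omega_{n-1}\frac{\Gamma(\frac{n-1}2)\Gamma(s+\frac12)}{2\,\Gamma(\frac n2+s)},\qquad \theta_0=\Big(\frac{\mu_0}{n\mu_1}\Big)^{\frac{n-1}{2s}}.$$ Then, for every $x\in\Omega$, the integral defining $L_Au(x)$ converges absolutely for every $A>0$ with $\det A=1$, the value $\mathcal D_su(x)$ is finite, and $$\mathcal D_su(x)=\mathcal D_s^\theta u(x)\qquad\text{for every }\theta<\theta_0 .$$ Moreover the fractional Monge–Ampère operator is uniformly elliptic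 on $u$ in $\Omega$: if $\Omega\neq\emptyset$ then $\theta_0>0$, and for $0<\theta<\theta_0$ all matrices $A$ competing in $\mathcal D_s^\theta$ have kernels comparable to that of the fractional Laplacian, $$\frac{\theta^{\,n+2s}}{|y|^{n+2s}}\le\frac1{|A^{-1}y|^{n+2s}}\le\frac{\theta^{(1-n)(n+2s)}}{|y|^{n+2s}}\qquad\text{for all }y\ne0 .$$ -/

import Mathlib

open MeasureTheory Set
open scoped NNReal

noncomputable section

namespace FracMA

/-- Euclidean space of dimension `n`. -/
abbrev E (n : ℕ) : Type := EuclideanSpace ℝ (Fin n)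

/-- The second-order increment `u(x+y) + u(x-y) - 2u(x)`. -/
def secondDiff {n : ℕ} (u : E n → ℝ) (x y : E n) : ℝ :=
  u (x + y) + u (x - y) - 2 * u x

/-- `u` is semiconcave in `D` with constant `C`. -/
def SemiconcaveOn {n : ℕ} (D : Set (E n)) (C : ℝ) (u : E n → ℝ) : Prop :=
  ContinuousOn u D ∧ 0 ≤ C ∧
    ∀ x y : E n, segment ℝ (x - y) (x + y) ⊆ D → secondDiff u x y ≤ C * ‖y‖ ^ 2

/-- The Lebesgue integral of a real function as an extended real number: the integral of the
positive part minus the integral of the negative part. It is the usual integral whenever one of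
the two is finite (the remaining, undefined, case `∞ - ∞` gets the value `-∞`). -/
def extIntegral {n : ℕ} (f : E n → ℝ) : EReal :=
  ((∫⁻ y, ENNReal.ofReal (f y) : ENNReal) : EReal)
    - ((∫⁻ y, ENNReal.ofReal (-f y) : ENNReal) : EReal)

/-- The kernel `|A⁻¹ y|^{-(n+2s)}`. -/
def kernel {n : ℕ} (s : ℝ) (A : Matrix (Fin n) (Fin n) ℝ) (y : E n) : ℝ :=
  (‖Matrix.toEuclideanCLM (𝕜 := ℝ) A⁻¹ y‖ ^ ((n : ℝ) + 2 * s))⁻¹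

/-- The linear operator `L_A u(x) = ½ ∫ (u(x+y) + u(x-y) - 2u(x)) / |A⁻¹ y|^{n+2s} dy`. -/
def linOp {n : ℕ} (s : ℝ) (A : Matrix (Fin n) (Fin n) ℝ) (u : E n → ℝ) (x : E n) : EReal :=
  extIntegral fun y => 1 / 2 * (secondDiff u x y * kernel s A y)

/-- Symmetric positive definite matrices of determinant one. -/
def unimodular (n : ℕ) : Set (Matrix (Fin n) (Fin n) ℝ) :=
  {A | A.PosDef ∧ A.det = 1}

/-- Symmetric positive definite matrices of determinant one whose smallest eigenvalue
is at least `θ`. -/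
def unimodularGE (n : ℕ) (θ : ℝ) : Set (Matrix (Fin n) (Fin n) ℝ) :=
  {A | ∃ hA : A.PosDef, A.det = 1 ∧ ∀ i, θ ≤ hA.isHermitian.eigenvalues i}

/-- The fractional Monge-Ampere operator `𝒟_s`. -/
def maOp {n : ℕ} (s : ℝ) (u : E n → ℝ) (x : E n) : EReal :=
  ⨅ A ∈ unimodular n, linOp s A u x

/-- The non-degenerate operator `𝒟_s^θ`: only matrices with `λ_min(A) ≥ θ` compete. -/
def maOpGE {n : ℕ} (s θ : ℝ) (u : E n → ℝ) (x : E n) : EReal :=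
  ⨅ A ∈ unimodularGE n θ, linOp s A u x

open scoped Classical in
/-- `𝒟_s u ≥ f` in `Ω` in the viscosity sense. -/
def IsViscositySubsolution {n : ℕ} (s : ℝ) (Ω : Set (E n)) (u f : E n → ℝ) : Prop :=
  UpperSemicontinuousOn u (closure Ω) ∧
    ∀ x ∈ Ω, ∀ N : Set (E n), IsOpen N → x ∈ N → N ⊆ Ω →
      ∀ ψ : E n → ℝ, ContDiffOn ℝ 2 ψ (closure N) → ψ x = u x →
        (∀ y ∈ N, y ≠ x → u y < ψ y) →
          (f x : EReal) ≤ maOp s (N.piecewise ψ u) x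

/-- `ω_k = 2 π^{k/2} / Γ(k/2)`, the surface measure of the unit sphere of `ℝ^k`. -/
def sphereArea (k : ℕ) : ℝ :=
  2 * Real.pi ^ ((k : ℝ) / 2) / Real.Gamma ((k : ℝ) / 2)

/-- `μ₁ = (1-s)/2 ∫_ℝ min{2L|t|, C|t|²} / |t|^{1+2s} dt`. -/
def mu₁ (s L C : ℝ) : ℝ :=
  (1 - s) / 2 * ∫ t : ℝ, min (2 * L * |t|) (C * |t| ^ 2) / |t| ^ (1 + 2 * s)

/-- `C₁ = √π Γ((n-1)/2 + s) / Γ(n/2 + s) · μ₁ ω_{n-1} / 2`. -/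
def const₁ (n : ℕ) (s L C : ℝ) : ℝ :=
  Real.sqrt Real.pi * Real.Gamma (((n : ℝ) - 1) / 2 + s) / Real.Gamma ((n : ℝ) / 2 + s)
    * (mu₁ s L C * sphereArea (n - 1) / 2)

/-- `C₂ = ω_{n-1} Γ((n-1)/2) Γ(s + 1/2) / (2 Γ(n/2 + s))`. -/
def const₂ (n : ℕ) (s : ℝ) : ℝ :=
  sphereArea (n - 1)
    * (Real.Gamma (((n : ℝ) - 1) / 2) * Real.Gamma (s + 1 / 2)
      / (2 * Real.Gamma ((n : ℝ) / 2 + s)))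

/-- `μ₀ = C₁^{1-n} C₂⁻¹ (η₀/2)^n`. -/
def mu₀ (n : ℕ) (s L C η₀ : ℝ) : ℝ :=
  const₁ n s L C ^ (1 - (n : ℝ)) * (const₂ n s)⁻¹ * (η₀ / 2) ^ n

/-- The threshold `(μ₀ / (n μ₁))^{(n-1)/(2s)}`. -/
def threshold (n : ℕ) (s L C η₀ : ℝ) : ℝ :=
  (mu₀ n s L C η₀ / (n * mu₁ s L C)) ^ (((n : ℝ) - 1) / (2 * s))

end FracMA

end

/-! ### Midpoint concavity, supporting hyperplanes, touching paraboloids -/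

noncomputable section

namespace FracMA

/-! The mechanism is that strict positivity of the operator forces every one-dimensional fractional
operator to be positive, after which a very elongated matrix costs more than the identity.

Viscosity inequality to pointwise inequality. Semiconcavity supplies at each point a paraboloid
touching from above. Testing with it on a ball of radius `r` and letting `r → 0` removes the
paraboloid, while monotone convergence recovers the whole negative part of the integrand. Hence all
integrals converge and `(1-s) L_A u(x) ≥ η₀` for each `A`
(`IsViscositySubsolution.integrable_and_le`).

Lower bound on lines. Let `A` act as `M` along a unit vector `e` and as `ε` on its complement, with
`M ε^(n-1) = 1`. Averaging over `w` and `-w` and using semiconcavity across the axis bounds `δ(te +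
w)` by `δ(te)` plus a modulus in `|w|`. The kernel has explicit marginals, so `η₀ ≤ C₂ M^(2s) J(e) +
C₁ ε^(2s)`, where `J(e)` is the operator on the line (`integral_stretch_le`). Choosing `ε` so that
the last term is `η₀/2` gives `J(e) ≥ μ₀` (`mu₀_le_line_integral`).

Comparison with the identity. In polar coordinates `(1-s) L_A u(x)` is half the integral over the
sphere of `|Aω|^(2s) J(Aω/|Aω|)`, hence at least `μ₀ λ^(2s) ω_n/(2n)` for any eigenvalue `λ`
(`le_integral_kernel`), while for the identity it is at most `μ₁ ω_n/2`. By the determinant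
condition an eigenvalue below `θ₀` forces another above `θ₀^(-1/(n-1))`, and `θ₀` is the value at
which these bounds meet. Thus matrices with a small eigenvalue never beat the identity, which is
itself admissible because `θ₀ ≤ 1`. -/

/-- At a minimum point `a`, take the largest step that stays in `[0,1]`: one end is an endpoint with
value `0`, the other has value at least `g a`, so `g a ≤ 2 g a`. -/
theorem nonneg_of_midpoint_concave {g : ℝ → ℝ} (hg : Continuous g) (h0 : g 0 = 0) (h1 : g 1 = 0)
    (hm : ∀ t r, g (t + r) + g (t - r) ≤ 2 * g t) {t : ℝ} (ht : t ∈ Icc (0 : ℝ) 1) : 0 ≤ g t := by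
  obtain ⟨a, ha, hmin⟩ := isCompact_Icc.exists_isMinOn ⟨t, ht⟩ hg.continuousOn
  refine le_trans ?_ (hmin ht)
  rcases le_total a (1 - a) with h | h
  · have h2 : g a ≤ g (a + a) := hmin ⟨by linarith [ha.1], by linarith⟩
    have h3 := hm a a
    rw [sub_self, h0] at h3
    linarith
  · have h2 : g a ≤ g (a - (1 - a)) := hmin ⟨by linarith, by linarith [ha.2]⟩
    have h3 := hm a (1 - a)
    rw [show a + (1 - a) = 1 by ring, h1] at h3
    linarith

theorem concaveOn_of_midpoint {V : Type*} [NormedAddCommGroup V] [NormedSpace ℝ V] {w : V → ℝ}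
    (hw : Continuous w) (hm : ∀ x y, w (x + y) + w (x - y) ≤ 2 * w x) : ConcaveOn ℝ univ w := by
  refine ⟨convex_univ, fun x _ y _ a b ha hb hab => ?_⟩
  have key := nonneg_of_midpoint_concave
    (g := fun t => w ((1 - t) • x + t • y) - ((1 - t) * w x + t * w y)) (by fun_prop)
    (by simp) (by simp) (fun t r => ?_) (t := b) ⟨hb, by linarith⟩
  · have : a = 1 - b := by linarith
    simp only [this, smul_eq_mul] at key ⊢
    linarith
  · have h := hm ((1 - t) • x + t • y) (r • (y - x))
    have e1 : (1 - t) • x + t • y + r • (y - x) = (1 - (t + r)) • x + (t + r) • y := by module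
    have e2 : (1 - t) • x + t • y - r • (y - x) = (1 - (t - r)) • x + (t - r) • y := by module
    rw [e1, e2] at h
    linarith

/-- A continuous concave function has a supporting affine function at every point. -/
theorem exists_supergradient {V : Type*} [NormedAddCommGroup V] [NormedSpace ℝ V] {w : V → ℝ}
    (hw : Continuous w) (hc : ConcaveOn ℝ univ w) (x : V) :
    ∃ l : V →L[ℝ] ℝ, ∀ y, w (x + y) ≤ w x + l y := by
  have hopen : IsOpen {p : V × ℝ | p.1 ∈ univ ∧ p.2 < w p.1} := by
    simp only [mem_univ, true_and]
    exact isOpen_lt continuous_snd (hw.comp continuous_fst)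
  obtain ⟨f, hf⟩ := geometric_hahn_banach_open_point (x := (x, w x)) hc.convex_strict_hypograph
    hopen (by simp)
  have hsplit : ∀ (y : V) (t : ℝ), f (y, t) = f (y, 0) + t * f (0, 1) := by
    intro y t
    have : (y, t) = (y, (0 : ℝ)) + t • ((0 : V), (1 : ℝ)) := by simp
    rw [this, map_add, map_smul, smul_eq_mul]
  -- The separating hyperplane is not vertical, because the hypograph contains points straight below
  -- `(x, w x)`; it is therefore the graph of an affine function.
  have hpos : 0 < f (0, 1) := by
    have h := hf (x, w x - 1) ⟨mem_univ _, by simp⟩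
    rw [hsplit x (w x - 1), hsplit x (w x)] at h
    linarith
  refine ⟨-((f (0, 1))⁻¹ • f.comp (ContinuousLinearMap.inl ℝ V ℝ)), fun y => ?_⟩
  refine le_of_forall_pos_lt_add fun ε hε => ?_
  have h := hf (x + y, w (x + y) - ε) ⟨mem_univ _, by simp [hε]⟩
  have hxy : f (x + y, 0) = f (x, 0) + f (y, 0) := by
    rw [← map_add]; simp
  rw [hsplit (x + y), hsplit x (w x), hxy] at h
  simp only [neg_apply, smul_apply,
    ContinuousLinearMap.comp_apply, ContinuousLinearMap.inl_apply, smul_eq_mul]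
  have h2 : (w (x + y) - ε - w x) < -((f (0, 1))⁻¹ * f (y, 0)) := by
    rw [← neg_mul, ← mul_neg_one, mul_assoc, mul_comm, ← div_eq_mul_inv, lt_div_iff₀ hpos]
    linarith
  linarith

/-- A semiconcave function is touched from above by a paraboloid at every point. -/
theorem SemiconcaveOn.exists_paraboloid {n : ℕ} {C : ℝ} {u : E n → ℝ}
    (hC : SemiconcaveOn univ C u) (x : E n) :
    ∃ l : E n →L[ℝ] ℝ, ∀ y, u (x + y) ≤ u x + l y + C / 2 * ‖y‖ ^ 2 := by
  obtain ⟨hu, -, hδ⟩ := hC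
  rw [continuousOn_univ] at hu
  -- Subtracting `C/2 ‖y‖²` makes `u` midpoint concave, since the parallelogram law computes the
  -- second difference of the square exactly.
  have hw : Continuous fun y => u (x + y) - C / 2 * ‖y‖ ^ 2 := by fun_prop
  have hm : ∀ a b : E n, u (x + (a + b)) - C / 2 * ‖a + b‖ ^ 2 +
      (u (x + (a - b)) - C / 2 * ‖a - b‖ ^ 2) ≤ 2 * (u (x + a) - C / 2 * ‖a‖ ^ 2) := by
    intro a b
    have h := hδ (x + a) b (subset_univ _)
    have hp := parallelogram_law_with_norm ℝ a b
    simp only [secondDiff, add_assoc, add_sub_assoc] at h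
    linear_combination h - C / 2 * hp
  obtain ⟨l, hl⟩ := exists_supergradient hw (concaveOn_of_midpoint hw hm) 0
  refine ⟨l, fun y => ?_⟩
  have := hl y
  simp only [zero_add, add_zero, norm_zero] at this
  linarith

/-! ### The beta integral -/

/-- Write `(1 + r²)^(-p)` as a Gamma integral of `exp(-(1 + r²)x)` and exchange the integrals: the
`r`-integral is Gaussian and the `x`-integral is again a Gamma function. Nonnegative integrals yield
the value and the convergence at once. -/
theorem lintegral_rpow_mul_one_add_sq_rpow {k p : ℝ} (hk : -1 < k) (hp : k + 1 < 2 * p) :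
    ∫⁻ r in Ioi (0 : ℝ), ENNReal.ofReal (r ^ k * (1 + r ^ 2) ^ (-p)) =
      ENNReal.ofReal (Real.Gamma ((k + 1) / 2) * Real.Gamma (p - (k + 1) / 2)
        / (2 * Real.Gamma p)) := by
  have hp0 : 0 < p := by linarith
  have hG : 0 < Real.Gamma p := Real.Gamma_pos_of_pos hp0
  have hΓ : ∀ b : ℝ, 0 < b → ∀ q : ℝ, 0 < q →
      ∫⁻ x in Ioi (0 : ℝ), ENNReal.ofReal (x ^ (q - 1) * Real.exp (-(b * x))) =
        ENNReal.ofReal (b ^ (-q) * Real.Gamma q) := by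
    intro b hb q hq
    have hint : IntegrableOn (fun x : ℝ => x ^ (q - 1) * Real.exp (-(b * x))) (Ioi 0) := by
      simpa using integrableOn_rpow_mul_exp_neg_mul_rpow (p := 1) (s := q - 1) (b := b)
        (by linarith) one_pos hb
    rw [← ofReal_integral_eq_lintegral_ofReal hint, Real.integral_rpow_mul_exp_neg_mul_Ioi hq hb,
      one_div, Real.inv_rpow hb.le, Real.rpow_neg hb.le]
    filter_upwards [ae_restrict_mem measurableSet_Ioi] with x hx
    have := mem_Ioi.1 hx
    positivity
  have hgauss : ∀ b : ℝ, 0 < b →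
      ∫⁻ r in Ioi (0 : ℝ), ENNReal.ofReal (r ^ k * Real.exp (-(b * r ^ 2))) =
        ENNReal.ofReal (b ^ (-((k + 1) / 2)) * (Real.Gamma ((k + 1) / 2) / 2)) := by
    intro b hb
    have hint : IntegrableOn (fun x : ℝ => x ^ k * Real.exp (-(b * x ^ 2))) (Ioi 0) := by
      simpa using integrableOn_rpow_mul_exp_neg_mul_rpow (p := 2) (s := k) (b := b)
        hk two_pos hb
    have hval : ∫ x in Ioi (0 : ℝ), x ^ k * Real.exp (-(b * x ^ 2)) =
        b ^ (-((k + 1) / 2)) * (Real.Gamma ((k + 1) / 2) / 2) := by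
      have := integral_rpow_mul_exp_neg_mul_rpow (p := 2) (q := k) (b := b) two_pos hk hb
      simp only [Real.rpow_ofNat, neg_mul] at this
      rw [this, neg_div]
      ring
    rw [← ofReal_integral_eq_lintegral_ofReal hint, hval]
    filter_upwards [ae_restrict_mem measurableSet_Ioi] with x hx
    have := mem_Ioi.1 hx
    positivity
  have h1 : ∀ r ∈ Ioi (0 : ℝ), ENNReal.ofReal (r ^ k * (1 + r ^ 2) ^ (-p)) =
      ENNReal.ofReal (Real.Gamma p)⁻¹ * ∫⁻ x in Ioi (0 : ℝ),
        ENNReal.ofReal (r ^ k * (x ^ (p - 1) * Real.exp (-((1 + r ^ 2) * x)))) := by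
    intro r hr
    have hr' := mem_Ioi.1 hr
    have hrk : 0 ≤ r ^ k := by positivity
    simp_rw [ENNReal.ofReal_mul hrk]
    rw [lintegral_const_mul _ (by fun_prop), hΓ _ (by positivity) _ hp0, ← ENNReal.ofReal_mul hrk,
      ← ENNReal.ofReal_mul hrk, ← ENNReal.ofReal_mul (by positivity)]
    congr 1
    field_simp
  rw [setLIntegral_congr_fun measurableSet_Ioi h1, lintegral_const_mul' _ _ ENNReal.ofReal_ne_top,
    lintegral_lintegral_swap (by fun_prop)]
  have h2 : ∀ x ∈ Ioi (0 : ℝ), ∫⁻ r in Ioi (0 : ℝ),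
        ENNReal.ofReal (r ^ k * (x ^ (p - 1) * Real.exp (-((1 + r ^ 2) * x)))) =
      ENNReal.ofReal (Real.Gamma ((k + 1) / 2) / 2) *
        ENNReal.ofReal (x ^ (p - (k + 1) / 2 - 1) * Real.exp (-(1 * x))) := by
    intro x hx
    have hx' := mem_Ioi.1 hx
    have e : ∀ r : ℝ, ENNReal.ofReal (r ^ k * (x ^ (p - 1) * Real.exp (-((1 + r ^ 2) * x)))) =
        ENNReal.ofReal (x ^ (p - 1) * Real.exp (-x)) *
          ENNReal.ofReal (r ^ k * Real.exp (-(x * r ^ 2))) := by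
      intro r
      rw [← ENNReal.ofReal_mul (by positivity),
        show -((1 + r ^ 2) * x) = -x + -(x * r ^ 2) by ring, Real.exp_add]
      congr 1
      ring
    have hG2 : 0 < Real.Gamma ((k + 1) / 2) := Real.Gamma_pos_of_pos (by linarith)
    simp_rw [e]
    rw [lintegral_const_mul _ (by fun_prop), hgauss x hx', ← ENNReal.ofReal_mul (by positivity),
      ← ENNReal.ofReal_mul (by positivity)]
    congr 1
    rw [show p - (k + 1) / 2 - 1 = (p - 1) + -((k + 1) / 2) by ring, Real.rpow_add hx', one_mul]
    ring
  rw [setLIntegral_congr_fun measurableSet_Ioi h2, lintegral_const_mul _ (by fun_prop),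
    hΓ 1 one_pos _ (by linarith)]
  have hG2 : 0 < Real.Gamma ((k + 1) / 2) := Real.Gamma_pos_of_pos (by linarith)
  rw [← ENNReal.ofReal_mul (by positivity), ← ENNReal.ofReal_mul (by positivity)]
  congr 1
  rw [Real.one_rpow]
  field_simp

theorem integrableOn_rpow_mul_one_add_sq_rpow {k p : ℝ} (hk : -1 < k) (hp : k + 1 < 2 * p) :
    IntegrableOn (fun r : ℝ => r ^ k * (1 + r ^ 2) ^ (-p)) (Ioi 0) := by
  refine ⟨by fun_prop, ?_⟩
  rw [hasFiniteIntegral_iff_ofReal, lintegral_rpow_mul_one_add_sq_rpow hk hp]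
  · exact ENNReal.ofReal_lt_top
  · filter_upwards [ae_restrict_mem measurableSet_Ioi] with x hx
    have := mem_Ioi.1 hx
    positivity

theorem integral_rpow_mul_one_add_sq_rpow {k p : ℝ} (hk : -1 < k) (hp : k + 1 < 2 * p) :
    ∫ r in Ioi (0 : ℝ), r ^ k * (1 + r ^ 2) ^ (-p) =
      Real.Gamma ((k + 1) / 2) * Real.Gamma (p - (k + 1) / 2) / (2 * Real.Gamma p) := by
  have h1 : 0 < Real.Gamma ((k + 1) / 2) := Real.Gamma_pos_of_pos (by linarith)
  have h2 : 0 < Real.Gamma (p - (k + 1) / 2) := Real.Gamma_pos_of_pos (by linarith)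
  have h3 : 0 < Real.Gamma p := Real.Gamma_pos_of_pos (by linarith)
  rw [integral_eq_lintegral_of_nonneg_ae ?_ (by fun_prop),
    lintegral_rpow_mul_one_add_sq_rpow hk hp, ENNReal.toReal_ofReal (by positivity)]
  filter_upwards [ae_restrict_mem measurableSet_Ioi] with x hx
  have := mem_Ioi.1 hx
  simp only [Pi.zero_apply]
  positivity

end FracMA

end

/-! ### Matrices of determinant one, their kernels and eigenvalues -/

noncomputable section

namespace FracMA

variable {n : ℕ} {A : Matrix (Fin n) (Fin n) ℝ}

theorem clm_apply_inv (hA : A ∈ unimodular n) (y : E n) :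
    Matrix.toEuclideanCLM (𝕜 := ℝ) A (Matrix.toEuclideanCLM (𝕜 := ℝ) A⁻¹ y) = y := by
  rw [← mul_apply_eq_comp, ← map_mul,
    Matrix.mul_nonsing_inv _ (by rw [hA.2]; exact isUnit_one), map_one,
    one_apply_eq_self]

theorem clm_inv_apply (hA : A ∈ unimodular n) (y : E n) :
    Matrix.toEuclideanCLM (𝕜 := ℝ) A⁻¹ (Matrix.toEuclideanCLM (𝕜 := ℝ) A y) = y := by
  rw [← mul_apply_eq_comp, ← map_mul,
    Matrix.nonsing_inv_mul _ (by rw [hA.2]; exact isUnit_one), map_one,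
    one_apply_eq_self]

theorem clm_ne_zero (hA : A ∈ unimodular n) {y : E n} (hy : y ≠ 0) :
    Matrix.toEuclideanCLM (𝕜 := ℝ) A y ≠ 0 := fun h => hy <| by
  rw [← clm_inv_apply hA y, h, map_zero]

theorem clm_inv_ne_zero (hA : A ∈ unimodular n) {y : E n} (hy : y ≠ 0) :
    Matrix.toEuclideanCLM (𝕜 := ℝ) A⁻¹ y ≠ 0 := fun h => hy <| by
  rw [← clm_apply_inv hA y, h, map_zero]

theorem one_mem_unimodular (n : ℕ) : (1 : Matrix (Fin n) (Fin n) ℝ) ∈ unimodular n :=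
  ⟨Matrix.PosDef.one, Matrix.det_one⟩

theorem measurePreserving (hA : A ∈ unimodular n) :
    MeasurePreserving (Matrix.toEuclideanCLM (𝕜 := ℝ) A) (volume : Measure (E n)) volume := by
  have hdet : LinearMap.det (Matrix.toEuclideanCLM (𝕜 := ℝ) A : E n →ₗ[ℝ] E n) = 1 := by
    rw [Matrix.coe_toEuclideanCLM_eq_toEuclideanLin, Matrix.toEuclideanLin_eq_toLin_orthonormal,
      LinearMap.det_toLin, hA.2]
  refine ⟨by fun_prop, ?_⟩
  have := Measure.map_linearMap_addHaar_eq_smul_addHaar (volume : Measure (E n))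
    (f := (Matrix.toEuclideanCLM (𝕜 := ℝ) A : E n →ₗ[ℝ] E n)) (by rw [hdet]; exact one_ne_zero)
  rw [hdet] at this
  simpa using this

theorem measurableEmbedding (hA : A ∈ unimodular n) :
    MeasurableEmbedding (Matrix.toEuclideanCLM (𝕜 := ℝ) A : E n → E n) :=
  MeasurableEquiv.measurableEmbedding
    { toFun := Matrix.toEuclideanCLM (𝕜 := ℝ) A
      invFun := Matrix.toEuclideanCLM (𝕜 := ℝ) A⁻¹
      left_inv := clm_inv_apply hA
      right_inv := clm_apply_inv hA
      measurable_toFun := (Matrix.toEuclideanCLM (𝕜 := ℝ) A).measurable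
      measurable_invFun := (Matrix.toEuclideanCLM (𝕜 := ℝ) A⁻¹).measurable }

theorem kernel_nonneg (s : ℝ) (A : Matrix (Fin n) (Fin n) ℝ) (y : E n) : 0 ≤ kernel s A y := by
  unfold kernel; positivity

@[fun_prop]
theorem measurable_kernel (s : ℝ) (A : Matrix (Fin n) (Fin n) ℝ) :
    Measurable (kernel (n := n) s A) := by
  unfold kernel; fun_prop

theorem kernel_one (s : ℝ) (y : E n) : kernel s 1 y = (‖y‖ ^ ((n : ℝ) + 2 * s))⁻¹ := by
  simp [kernel]

theorem kernel_clm (hA : A ∈ unimodular n) (s : ℝ) (y : E n) :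
    kernel s A (Matrix.toEuclideanCLM (𝕜 := ℝ) A y) = kernel s 1 y := by
  rw [kernel_one, kernel, clm_inv_apply hA]

theorem kernel_le (hA : A ∈ unimodular n) {s : ℝ} (hs : 0 ≤ s) (y : E n) :
    kernel s A y ≤
      ‖Matrix.toEuclideanCLM (𝕜 := ℝ) A‖ ^ ((n : ℝ) + 2 * s) * kernel s 1 y := by
  -- At the origin both kernels take the default value `0⁻¹ = 0`, unless the exponent vanishes.
  rcases eq_or_ne y 0 with rfl | hy
  · rcases (show 0 ≤ (n : ℝ) + 2 * s by positivity).eq_or_lt with h | h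
    · simp [kernel, ← h]
    · simp [kernel, Real.zero_rpow h.ne']
  have h1 : 0 < ‖Matrix.toEuclideanCLM (𝕜 := ℝ) A⁻¹ y‖ := norm_pos_iff.2 (clm_inv_ne_zero hA hy)
  have h2 : 0 < ‖y‖ := norm_pos_iff.2 hy
  rw [kernel_one, kernel, ← div_eq_mul_inv, le_div_iff₀ (by positivity), inv_mul_le_iff₀
    (by positivity), ← Real.mul_rpow (by positivity) (by positivity),
    mul_comm ‖Matrix.toEuclideanCLM (𝕜 := ℝ) A⁻¹ y‖]
  refine Real.rpow_le_rpow h2.le ?_ (by positivity)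
  calc ‖y‖ = ‖Matrix.toEuclideanCLM (𝕜 := ℝ) A (Matrix.toEuclideanCLM (𝕜 := ℝ) A⁻¹ y)‖ := by
        rw [clm_apply_inv hA]
    _ ≤ _ := ContinuousLinearMap.le_opNorm _ _

theorem inner_clm_eigenvectorBasis (hA : A.IsHermitian) (i : Fin n) (y : E n) :
    inner ℝ (hA.eigenvectorBasis i) (Matrix.toEuclideanCLM (𝕜 := ℝ) A y) =
      hA.eigenvalues i * inner ℝ (hA.eigenvectorBasis i) y := by
  have h1 : Matrix.toEuclideanLin A (hA.eigenvectorBasis i) =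
      hA.eigenvalues i • hA.eigenvectorBasis i := by
    ext j
    exact congrFun (hA.mulVec_eigenvectorBasis i) j
  have h2 := Matrix.isSymmetric_toEuclideanLin_iff.2 hA (hA.eigenvectorBasis i) y
  rw [h1, inner_smul_left] at h2
  simpa [← Matrix.coe_toEuclideanCLM_eq_toEuclideanLin] using h2.symm

theorem eigenvalue_mul_abs_inner_le (hA : A.PosDef) (i : Fin n) (y : E n) :
    hA.isHermitian.eigenvalues i * |inner ℝ (hA.isHermitian.eigenvectorBasis i) y| ≤
      ‖Matrix.toEuclideanCLM (𝕜 := ℝ) A y‖ := by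
  have h := abs_real_inner_le_norm (hA.isHermitian.eigenvectorBasis i)
    (Matrix.toEuclideanCLM (𝕜 := ℝ) A y)
  rwa [inner_clm_eigenvectorBasis, abs_mul, abs_of_pos (hA.eigenvalues_pos i),
    OrthonormalBasis.norm_eq_one, one_mul] at h

theorem norm_sq_clm (hA : A.IsHermitian) (y : E n) :
    ‖Matrix.toEuclideanCLM (𝕜 := ℝ) A y‖ ^ 2 =
      ∑ i, (hA.eigenvalues i * inner ℝ (hA.eigenvectorBasis i) y) ^ 2 := by
  rw [← hA.eigenvectorBasis.sum_sq_norm_inner_right]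
  simp_rw [inner_clm_eigenvectorBasis, Real.norm_eq_abs, sq_abs]

theorem mul_norm_le_norm_clm (hA : A.IsHermitian) {θ : ℝ} (hθ : 0 ≤ θ)
    (h : ∀ i, θ ≤ hA.eigenvalues i) (y : E n) :
    θ * ‖y‖ ≤ ‖Matrix.toEuclideanCLM (𝕜 := ℝ) A y‖ := by
  refine le_of_sq_le_sq ?_ (norm_nonneg _)
  rw [norm_sq_clm hA, mul_pow, ← hA.eigenvectorBasis.sum_sq_norm_inner_right y, Finset.mul_sum]
  refine Finset.sum_le_sum fun i _ => ?_
  rw [mul_pow, Real.norm_eq_abs, sq_abs]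
  gcongr
  exact h i

theorem norm_clm_le_mul_norm (hA : A.PosDef) {R : ℝ} (hR : 0 ≤ R)
    (h : ∀ i, hA.isHermitian.eigenvalues i ≤ R) (y : E n) :
    ‖Matrix.toEuclideanCLM (𝕜 := ℝ) A y‖ ≤ R * ‖y‖ := by
  refine le_of_sq_le_sq ?_ (by positivity)
  rw [norm_sq_clm hA.isHermitian, mul_pow,
    ← hA.isHermitian.eigenvectorBasis.sum_sq_norm_inner_right y, Finset.mul_sum]
  refine Finset.sum_le_sum fun i _ => ?_
  rw [mul_pow, Real.norm_eq_abs, sq_abs]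
  gcongr
  · exact (hA.eigenvalues_pos i).le
  · exact h i

theorem prod_eigenvalues_eq_one (hA : A.IsHermitian) (hdet : A.det = 1) :
    ∏ i, hA.eigenvalues i = 1 := by
  have := hA.det_eq_prod_eigenvalues
  rw [hdet] at this
  simpa using this.symm

/-- The other `n - 1` eigenvalues have product at least `θ^(n-1)`, and the full product is `1`. -/
theorem eigenvalue_le_rpow (hA : A.PosDef) (hdet : A.det = 1) {θ : ℝ} (hθ : 0 < θ)
    (h : ∀ i, θ ≤ hA.isHermitian.eigenvalues i) (i : Fin n) :
    hA.isHermitian.eigenvalues i ≤ θ ^ (1 - (n : ℝ)) := by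
  have hprod := prod_eigenvalues_eq_one hA.isHermitian hdet
  rw [← Finset.mul_prod_erase _ _ (Finset.mem_univ i)] at hprod
  have h1 : θ ^ (n - 1) ≤ ∏ j ∈ Finset.univ.erase i, hA.isHermitian.eigenvalues j := by
    have := Finset.prod_le_prod (s := Finset.univ.erase i) (f := fun _ => θ)
      (g := hA.isHermitian.eigenvalues) (fun _ _ => hθ.le) (fun j _ => h j)
    simpa [Finset.card_erase_of_mem] using this
  have hn : 1 ≤ n := Fin.pos i
  have h2 : θ ^ (1 - (n : ℝ)) = (θ ^ (n - 1))⁻¹ := by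
    rw [← Real.rpow_natCast, ← Real.rpow_neg hθ.le, Nat.cast_sub hn]
    congr 1
    push_cast
    ring
  have hpos := hA.eigenvalues_pos i
  rw [h2, ← one_div, le_div_iff₀ (by positivity), ← hprod]
  gcongr

/-- Otherwise the other `n - 1` eigenvalues would have product below the inverse of the `i`-th one,
contradicting determinant one. This turns a small eigenvalue into a large one. -/
theorem exists_rpow_le_eigenvalue (hn : 2 ≤ n) (hA : A.PosDef) (hdet : A.det = 1) (i : Fin n) :
    ∃ j, hA.isHermitian.eigenvalues i ^ (-(1 / ((n : ℝ) - 1))) ≤ hA.isHermitian.eigenvalues j := by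
  by_contra! hcon
  have hprod := prod_eigenvalues_eq_one hA.isHermitian hdet
  rw [← Finset.mul_prod_erase _ _ (Finset.mem_univ i)] at hprod
  have hpos := hA.eigenvalues_pos i
  set c := hA.isHermitian.eigenvalues i
  have hcard : (Finset.univ.erase i).card = n - 1 := by simp
  have h1 : ∏ j ∈ Finset.univ.erase i, hA.isHermitian.eigenvalues j <
      ∏ j ∈ Finset.univ.erase i, c ^ (-(1 / ((n : ℝ) - 1))) := by
    refine Finset.prod_lt_prod_of_nonempty (fun j _ => hA.eigenvalues_pos j)
      (fun j _ => hcon j) (Finset.card_pos.1 (by omega))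
  have hn1 : (n : ℝ) - 1 ≠ 0 := by
    have : (2 : ℝ) ≤ n := by exact_mod_cast hn
    linarith
  rw [Finset.prod_const, hcard, ← Real.rpow_natCast, ← Real.rpow_mul hpos.le,
    Nat.cast_sub (by omega), Nat.cast_one, neg_mul, one_div, inv_mul_cancel₀ hn1,
    Real.rpow_neg_one] at h1
  have h2 := mul_lt_mul_of_pos_left h1 hpos
  rw [hprod, mul_inv_cancel₀ hpos.ne'] at h2
  exact lt_irrefl _ h2

/-- Matrices of determinant one with eigenvalues at least `θ` have kernels comparable to the
isotropic one. -/
theorem kernel_comparable {s θ : ℝ} (hs : 0 ≤ s) (hθ : 0 < θ) (hA : A ∈ unimodularGE n θ) {y : E n}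
    (hy : y ≠ 0) :
    θ ^ ((n : ℝ) + 2 * s) / ‖y‖ ^ ((n : ℝ) + 2 * s) ≤ kernel s A y ∧
      kernel s A y ≤ (θ ^ (1 - (n : ℝ))) ^ ((n : ℝ) + 2 * s) / ‖y‖ ^ ((n : ℝ) + 2 * s) := by
  obtain ⟨hpd, hdet, hge⟩ := hA
  have hu : A ∈ unimodular n := ⟨hpd, hdet⟩
  have hy' : 0 < ‖y‖ := norm_pos_iff.2 hy
  have hz : 0 < ‖Matrix.toEuclideanCLM (𝕜 := ℝ) A⁻¹ y‖ := norm_pos_iff.2 (clm_inv_ne_zero hu hy)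
  have h1 := mul_norm_le_norm_clm hpd.isHermitian hθ.le hge (Matrix.toEuclideanCLM (𝕜 := ℝ) A⁻¹ y)
  have h2 := norm_clm_le_mul_norm hpd (by positivity) (eigenvalue_le_rpow hpd hdet hθ hge)
    (Matrix.toEuclideanCLM (𝕜 := ℝ) A⁻¹ y)
  rw [clm_apply_inv hu] at h1 h2
  have hp : 0 ≤ (n : ℝ) + 2 * s := by positivity
  rw [kernel, ← one_div, div_le_div_iff₀ (by positivity) (by positivity),
    div_le_div_iff₀ (by positivity) (by positivity), one_mul,
    ← Real.mul_rpow (by positivity) (by positivity), ← Real.mul_rpow (by positivity) (by positivity)]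
  exact ⟨Real.rpow_le_rpow (by positivity) h1 hp, Real.rpow_le_rpow (by positivity) h2 hp⟩

/-- The matrix acting as `M` on the line spanned by a unit vector `e` and as `ε` on its orthogonal
complement. -/
def stretch (e : E n) (M ε : ℝ) : Matrix (Fin n) (Fin n) ℝ :=
  ε • 1 + (M - ε) • Matrix.vecMulVec e.ofLp e.ofLp

theorem clm_stretch (e : E n) (M ε : ℝ) (y : E n) :
    Matrix.toEuclideanCLM (𝕜 := ℝ) (stretch e M ε) y =
      ε • y + ((M - ε) * inner ℝ e y) • e := by
  ext j
  simp only [stretch, Matrix.ofLp_toEuclideanCLM, Matrix.add_mulVec, Matrix.smul_mulVec,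
    Matrix.vecMulVec_mulVec, Matrix.one_mulVec, EuclideanSpace.inner_eq_star_dotProduct,
    PiLp.add_apply, PiLp.smul_apply, Pi.add_apply, Pi.smul_apply, smul_eq_mul,
    MulOpposite.smul_eq_mul_unop, MulOpposite.unop_op, star_trivial]
  rw [dotProduct_comm]
  ring

theorem isHermitian_stretch (e : E n) (M ε : ℝ) : (stretch e M ε).IsHermitian := by
  ext i j
  simp only [stretch, Matrix.conjTranspose_apply, Matrix.add_apply, Matrix.smul_apply,
    Matrix.vecMulVec_apply, Matrix.one_apply, star_trivial, eq_comm (a := i) (b := j),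
    mul_comm (e.ofLp i)]

theorem stretch_mem_unimodular (hn : 1 ≤ n) {e : E n} (he : ‖e‖ = 1) {M ε : ℝ} (hM : 0 < M)
    (hε : 0 < ε) (h : M * ε ^ (n - 1) = 1) : stretch e M ε ∈ unimodular n := by
  have hee : e.ofLp ⬝ᵥ e.ofLp = 1 := by
    have := real_inner_self_eq_norm_sq e
    rw [he, EuclideanSpace.inner_eq_star_dotProduct] at this
    simpa using this
  refine ⟨Matrix.PosDef.of_dotProduct_mulVec_pos (isHermitian_stretch e M ε) fun x hx => ?_, ?_⟩
  · have hx' : WithLp.toLp 2 x ≠ (0 : E n) := by simpa using hx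
    have h1 : star x ⬝ᵥ (stretch e M ε).mulVec x = inner ℝ (WithLp.toLp 2 x)
        (Matrix.toEuclideanCLM (𝕜 := ℝ) (stretch e M ε) (WithLp.toLp 2 x)) := by
      rw [EuclideanSpace.inner_eq_star_dotProduct, Matrix.ofLp_toEuclideanCLM, dotProduct_comm]
    rw [h1, clm_stretch, inner_add_right, inner_smul_right, inner_smul_right,
      real_inner_self_eq_norm_sq, real_inner_comm e]
    have h2 := abs_real_inner_le_norm e (WithLp.toLp 2 x)
    rw [he, one_mul] at h2
    have h3 : inner ℝ e (WithLp.toLp 2 x) ^ 2 ≤ ‖WithLp.toLp 2 x‖ ^ 2 := by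
      rw [← sq_abs]
      gcongr
    have h4 : 0 < ‖WithLp.toLp 2 x‖ ^ 2 := by positivity
    -- The quadratic form is `ε(‖x‖² - ⟨e,x⟩²) + M⟨e,x⟩²`; when the second term vanishes the first
    -- is `ε‖x‖²`.
    rcases (sq_nonneg (inner ℝ e (WithLp.toLp 2 x))).eq_or_lt with h5 | h5
    · have h6 := sq_eq_zero_iff.1 h5.symm
      rw [h6]
      have := mul_pos hε h4
      linarith
    · have := mul_pos hM h5
      have := mul_nonneg hε.le (sub_nonneg.2 h3)
      nlinarith
  -- As `ε` times a rank-one perturbation of the identity, the matrix has determinant `ε^n (1 +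
  -- (M-ε)/ε) = M ε^(n-1)`.
  · have h1 : stretch e M ε =
        ε • (1 + Matrix.replicateCol Unit (((M - ε) / ε) • e.ofLp) *
          Matrix.replicateRow Unit e.ofLp) := by
      rw [← Matrix.vecMulVec_eq, Matrix.smul_vecMulVec, smul_add, smul_smul,
        mul_div_cancel₀ _ hε.ne', stretch]
    rw [h1, Matrix.det_smul, Matrix.det_one_add_replicateCol_mul_replicateRow, dotProduct_smul, hee,
      Fintype.card_fin]
    obtain ⟨m, rfl⟩ : ∃ m, n = m + 1 := ⟨n - 1, by omega⟩
    rw [Nat.add_sub_cancel] at h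
    rw [smul_eq_mul, pow_succ, mul_one, mul_assoc, mul_add, mul_div_cancel₀ _ hε.ne']
    linear_combination h

theorem stretch_inv {e : E n} (he : ‖e‖ = 1) {M ε : ℝ} (hM : M ≠ 0) (hε : ε ≠ 0) :
    (stretch e M ε)⁻¹ = stretch e M⁻¹ ε⁻¹ := by
  refine Matrix.inv_eq_right_inv ?_
  apply EquivLike.injective (Matrix.toEuclideanCLM (𝕜 := ℝ) (n := Fin n))
  rw [map_mul, map_one]
  ext1 y
  rw [mul_apply_eq_comp, clm_stretch, clm_stretch]
  simp only [inner_add_right, inner_smul_right, real_inner_self_eq_norm_sq, he,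
    one_apply_eq_self, smul_add, smul_smul, add_assoc, ← add_smul]
  rw [mul_inv_cancel₀ hε, one_smul]
  convert add_zero y using 2
  convert zero_smul ℝ e
  field_simp
  ring

end FracMA

end

/-! ### The modulus, radial integrals, and the operator as a real integral -/

noncomputable section

namespace FracMA

/-- The bound `min {2L|r|, C|r|²}` for second differences of an `L`-Lipschitz function with
semiconcavity constant `C`. -/
def modulus (L C r : ℝ) : ℝ := min (2 * L * |r|) (C * |r| ^ 2)

@[fun_prop]
theorem continuous_modulus (L C : ℝ) : Continuous (modulus L C) := by
  unfold modulus; fun_prop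

theorem modulus_nonneg {L C : ℝ} (hL : 0 ≤ L) (hC : 0 ≤ C) (r : ℝ) : 0 ≤ modulus L C r := by
  unfold modulus; positivity

theorem modulus_abs (L C r : ℝ) : modulus L C |r| = modulus L C r := by
  simp [modulus]

/-- Near `0` the quadratic bound gives `r^(1-2s)`, integrable because `s < 1`; at infinity the
Lipschitz bound gives `r^(-2s)`, integrable because `s > 1/2`. -/
theorem integrableOn_modulus {L C s : ℝ} (hL : 0 ≤ L) (hC : 0 ≤ C) (hs : 1 / 2 < s) (hs' : s < 1) :
    IntegrableOn (fun r => modulus L C r / r ^ (1 + 2 * s)) (Ioi 0) := by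
  have hmeas : Measurable fun r => modulus L C r / r ^ (1 + 2 * s) := by fun_prop
  rw [← Ioc_union_Ioi_eq_Ioi (zero_le_one' ℝ)]
  refine IntegrableOn.union ?_ ?_
  · have h : IntegrableOn (fun r : ℝ => C * r ^ (1 - 2 * s)) (Ioc 0 1) := by
      refine Integrable.const_mul ?_ C
      exact (intervalIntegrable_iff_integrableOn_Ioc_of_le zero_le_one).1
        (intervalIntegral.intervalIntegrable_rpow' (by linarith))
    refine h.mono' hmeas.aestronglyMeasurable ?_
    filter_upwards [ae_restrict_mem measurableSet_Ioc] with r hr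
    have hr0 : 0 < r := hr.1
    have := modulus_nonneg hL hC r
    rw [Real.norm_of_nonneg (by positivity), div_le_iff₀ (by positivity), mul_assoc,
      ← Real.rpow_add hr0, show 1 - 2 * s + (1 + 2 * s) = (2 : ℕ) by push_cast; ring,
      Real.rpow_natCast]
    exact (min_le_right _ _).trans_eq (by rw [sq_abs])
  · have h : IntegrableOn (fun r : ℝ => 2 * L * r ^ (-(2 * s))) (Ioi 1) :=
      (integrableOn_Ioi_rpow_of_lt (by linarith) one_pos).const_mul _
    refine h.mono' hmeas.aestronglyMeasurable ?_
    filter_upwards [ae_restrict_mem measurableSet_Ioi] with r hr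
    have hr0 : 0 < r := one_pos.trans hr
    have := modulus_nonneg hL hC r
    rw [Real.norm_of_nonneg (by positivity), div_le_iff₀ (by positivity), mul_assoc,
      ← Real.rpow_add hr0, show -(2 * s) + (1 + 2 * s) = 1 by ring, Real.rpow_one]
    exact (min_le_left _ _).trans_eq (by rw [abs_of_pos hr0])

theorem integrable_modulus {L C s : ℝ} (hL : 0 ≤ L) (hC : 0 ≤ C) (hs : 1 / 2 < s) (hs' : s < 1) :
    Integrable (fun r => modulus L C r / |r| ^ (1 + 2 * s)) := by
  have h := (integrable_fun_norm_addHaar (volume : Measure ℝ)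
    (f := fun r => modulus L C r / r ^ (1 + 2 * s))).2
    (by simpa using integrableOn_modulus hL hC hs hs')
  simpa [Real.norm_eq_abs, modulus_abs] using h

theorem mu₁_eq (s L C : ℝ) :
    mu₁ s L C = (1 - s) * ∫ r in Ioi (0 : ℝ), modulus L C r / r ^ (1 + 2 * s) := by
  have h := integral_comp_abs (f := fun r => modulus L C r / r ^ (1 + 2 * s))
  simp only [modulus_abs] at h
  simp only [mu₁]
  change (1 - s) / 2 * ∫ t : ℝ, modulus L C t / |t| ^ (1 + 2 * s) = _
  rw [h]
  ring

section Radial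

variable {V : Type*} [NormedAddCommGroup V] [InnerProductSpace ℝ V] [FiniteDimensional ℝ V]
  [MeasurableSpace V] [BorelSpace V] [Nontrivial V]

theorem finrank_mul_volume_unitBall :
    (Module.finrank ℝ V : ℝ) * (volume : Measure V).real (Metric.ball 0 1) =
      sphereArea (Module.finrank ℝ V) := by
  have hd : 0 < Module.finrank ℝ V := Module.finrank_pos
  set d := Module.finrank ℝ V
  have hd' : (0 : ℝ) < d := by exact_mod_cast hd
  have hG : 0 < Real.Gamma ((d : ℝ) / 2) := Real.Gamma_pos_of_pos (by positivity)
  have h1 : Real.Gamma ((d : ℝ) / 2 + 1) = (d : ℝ) / 2 * Real.Gamma ((d : ℝ) / 2) :=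
    Real.Gamma_add_one (by positivity)
  have h2 : √Real.pi ^ d = Real.pi ^ ((d : ℝ) / 2) := by
    rw [Real.sqrt_eq_rpow, ← Real.rpow_natCast, ← Real.rpow_mul Real.pi_pos.le]
    congr 1
    ring
  rw [measureReal_def, InnerProductSpace.volume_ball, ENNReal.ofReal_one, one_pow, one_mul,
    ENNReal.toReal_ofReal (by rw [h1]; positivity), h1, h2, sphereArea]
  field_simp

theorem integral_radial (f : ℝ → ℝ) :
    ∫ x : V, f ‖x‖ = sphereArea (Module.finrank ℝ V) *
      ∫ r in Ioi (0 : ℝ), r ^ (Module.finrank ℝ V - 1) * f r := by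
  rw [integral_fun_norm_addHaar, ← finrank_mul_volume_unitBall]
  simp [mul_assoc]

/-- The polar Jacobian absorbs the dimension, so kernels of order `d + 2s` in any dimension reduce
to the same half-line integral; this is why a single `μ₁` serves for both `n` and `n - 1`. -/
theorem pow_mul_div_rpow {d : ℕ} (hd : 0 < d) {r : ℝ} (hr : 0 < r) (a q : ℝ) :
    r ^ (d - 1) * (a * (r ^ ((d : ℝ) + q))⁻¹) = a / r ^ (1 + q) := by
  have h : r ^ ((d : ℝ) + q) = r ^ (d - 1) * r ^ (1 + q) := by
    rw [← Real.rpow_natCast r (d - 1), ← Real.rpow_add hr, Nat.cast_sub hd]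
    congr 1
    push_cast
    ring
  rw [h]
  field_simp

theorem integrable_modulus_norm {L C s : ℝ} (hL : 0 ≤ L) (hC : 0 ≤ C) (hs : 1 / 2 < s)
    (hs' : s < 1) {d : ℕ} (hd : Module.finrank ℝ V = d) :
    Integrable fun y : V => modulus L C ‖y‖ * (‖y‖ ^ ((d : ℝ) + 2 * s))⁻¹ := by
  refine (integrable_fun_norm_addHaar (volume : Measure V)
    (f := fun r => modulus L C r * (r ^ ((d : ℝ) + 2 * s))⁻¹)).2 ?_
  refine (integrableOn_congr_fun (fun r hr => ?_) measurableSet_Ioi).1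
    (integrableOn_modulus hL hC hs hs')
  rw [hd, smul_eq_mul, pow_mul_div_rpow (hd ▸ Module.finrank_pos) hr]

theorem integral_modulus_norm (L C : ℝ) {s : ℝ} (hs' : s < 1) {d : ℕ}
    (hd : Module.finrank ℝ V = d) :
    ∫ y : V, modulus L C ‖y‖ * (‖y‖ ^ ((d : ℝ) + 2 * s))⁻¹ =
      sphereArea d * (mu₁ s L C / (1 - s)) := by
  rw [integral_radial (fun r => modulus L C r * (r ^ ((d : ℝ) + 2 * s))⁻¹), hd, mu₁_eq,
    mul_div_cancel_left₀ _ (by linarith)]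
  congr 1
  refine setIntegral_congr_fun measurableSet_Ioi fun r hr => ?_
  exact pow_mul_div_rpow (hd ▸ Module.finrank_pos) hr _ _

end Radial

theorem sphereArea_pos {k : ℕ} (hk : 0 < k) : 0 < sphereArea k := by
  have : (0 : ℝ) < k := by exact_mod_cast hk
  have : 0 < Real.Gamma ((k : ℝ) / 2) := Real.Gamma_pos_of_pos (by positivity)
  unfold sphereArea
  positivity

variable {n : ℕ} {u : E n → ℝ} {L : ℝ≥0} {C : ℝ}

theorem secondDiff_neg (u : E n → ℝ) (x y : E n) : secondDiff u x (-y) = secondDiff u x y := by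
  simp only [secondDiff, sub_neg_eq_add, ← sub_eq_add_neg]
  ring

@[fun_prop]
theorem continuous_secondDiff (hu : Continuous u) (x : E n) : Continuous (secondDiff u x) := by
  unfold secondDiff; fun_prop

theorem abs_secondDiff_le (hL : LipschitzWith L u) (x y : E n) :
    |secondDiff u x y| ≤ 2 * L * ‖y‖ := by
  have h1 := hL.dist_le_mul (x + y) x
  have h2 := hL.dist_le_mul (x - y) x
  rw [Real.dist_eq, dist_eq_norm] at h1 h2
  simp only [add_sub_cancel_left, sub_sub_cancel_left, norm_neg] at h1 h2
  have h3 : secondDiff u x y = (u (x + y) - u x) + (u (x - y) - u x) := by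
    unfold secondDiff; ring
  rw [h3]
  exact (abs_add_le _ _).trans (by linarith)

theorem secondDiff_le_modulus (hL : LipschitzWith L u) (hC : SemiconcaveOn univ C u) (x y : E n) :
    secondDiff u x y ≤ modulus L C ‖y‖ := by
  rw [modulus, abs_norm]
  exact le_min ((le_abs_self _).trans (abs_secondDiff_le hL x y)) (hC.2.2 x y (subset_univ _))

theorem integrable_modulus_kernel (hn : 1 ≤ n) {L C s : ℝ} (hL : 0 ≤ L) (hC : 0 ≤ C)
    (hs : 1 / 2 < s) (hs' : s < 1) {A : Matrix (Fin n) (Fin n) ℝ} (hA : A ∈ unimodular n) :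
    Integrable fun y : E n => modulus L C ‖y‖ * kernel s A y := by
  have : Nonempty (Fin n) := ⟨⟨0, hn⟩⟩
  have h := (integrable_modulus_norm (V := E n) hL hC hs hs' (d := n) (by simp)).const_mul
    (‖Matrix.toEuclideanCLM (𝕜 := ℝ) A‖ ^ ((n : ℝ) + 2 * s))
  refine h.mono' (by fun_prop) (ae_of_all _ fun y => ?_)
  have h1 := modulus_nonneg hL hC ‖y‖
  have h2 := kernel_le hA (by linarith : 0 ≤ s) y
  rw [Real.norm_of_nonneg (mul_nonneg h1 (kernel_nonneg s A y))]
  rw [kernel_one] at h2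
  calc _ ≤ modulus L C ‖y‖ * _ := mul_le_mul_of_nonneg_left h2 h1
    _ = _ := by ring

theorem linOp_eq_integral {s : ℝ} {A : Matrix (Fin n) (Fin n) ℝ} {x : E n}
    (h : Integrable fun y => secondDiff u x y * kernel s A y) :
    linOp s A u x = ((1 / 2 * ∫ y, secondDiff u x y * kernel s A y : ℝ) : EReal) := by
  have hf := h.const_mul (1 / 2)
  rw [← integral_const_mul, integral_eq_lintegral_pos_part_sub_lintegral_neg_part hf, linOp,
    extIntegral, EReal.coe_sub]
  have h1 := hf.lintegral_lt_top
  have h2 := hf.neg.lintegral_lt_top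
  simp only [Pi.neg_apply] at h2
  rw [EReal.coe_ennreal_toReal h1.ne, EReal.coe_ennreal_toReal h2.ne]

end FracMA

end

/-! ### From the viscosity inequality to the pointwise one -/

noncomputable section

namespace FracMA

open Filter Topology

variable {n : ℕ} {u : E n → ℝ} {L : ℝ≥0} {C s : ℝ}

/-- Continuity from below of the measure with density `F`: the complements increase and miss at most
the origin, a null set since `n ≥ 1`. -/
theorem tendsto_setLIntegral_compl_ball (hn : 1 ≤ n) {F : E n → ENNReal}
    {r : ℕ → ℝ} (hr : Antitone r) (hr0 : Tendsto r atTop (𝓝 0)) :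
    Tendsto (fun k => ∫⁻ y in (Metric.ball 0 (r k))ᶜ, F y) atTop (𝓝 (∫⁻ y, F y)) := by
  have : Nonempty (Fin n) := ⟨⟨0, hn⟩⟩
  have hmono : Monotone fun k => (Metric.ball (0 : E n) (r k))ᶜ := fun i j hij =>
    compl_subset_compl.2 (Metric.ball_subset_ball (hr hij))
  have h := tendsto_measure_iUnion_atTop (μ := (volume : Measure (E n)).withDensity F) hmono
  have hsub : ({0}ᶜ : Set (E n)) ⊆ ⋃ k, (Metric.ball (0 : E n) (r k))ᶜ := by
    intro y hy
    have hy' : 0 < ‖y‖ := norm_pos_iff.2 hy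
    obtain ⟨k, hk⟩ := (hr0.eventually_lt_const hy').exists
    exact mem_iUnion.2 ⟨k, by simpa using hk.le⟩
  have hUnion : (volume : Measure (E n)).withDensity F (⋃ k, (Metric.ball (0 : E n) (r k))ᶜ) =
      ∫⁻ y, F y := by
    refine le_antisymm ?_ ?_
    · exact (measure_mono (subset_univ _)).trans_eq (by rw [withDensity_apply _ .univ,
        Measure.restrict_univ])
    · refine le_trans ?_ (measure_mono hsub)
      rw [withDensity_apply _ (measurableSet_singleton _).compl, restrict_compl_singleton]
  rw [hUnion] at h
  refine h.congr fun k => ?_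
  simp only [Function.comp_apply]
  rw [withDensity_apply _ measurableSet_ball.compl]

/-- Moving the negative part to the left avoids subtraction of infinities, so that limits can be
taken before either part is known to be finite. -/
theorem ofReal_add_le_of_coe_le_sub {η : ℝ} (hη : 0 ≤ η) {a b : ENNReal}
    (hab : (η : EReal) ≤ (a : EReal) - (b : EReal)) : ENNReal.ofReal η + b ≤ a := by
  by_cases ha : a = ⊤
  · rw [ha]; exact le_top
  by_cases hb : b = ⊤
  · rw [hb, EReal.coe_ennreal_top, EReal.sub_top] at hab
    exact absurd (le_bot_iff.1 hab) (EReal.coe_ne_bot η)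
  rw [← EReal.coe_ennreal_toReal ha, ← EReal.coe_ennreal_toReal hb, ← EReal.coe_sub,
    EReal.coe_le_coe_iff] at hab
  rw [← ENNReal.toReal_le_toReal (ENNReal.add_ne_top.2 ⟨ENNReal.ofReal_ne_top, hb⟩) ha,
    ENNReal.toReal_add ENNReal.ofReal_ne_top hb, ENNReal.toReal_ofReal hη]
  linarith

/-- Testing with the touching paraboloid on a small ball: estimate with the truncated negative
part. -/
theorem IsViscositySubsolution.add_lintegral_neg_le
    (hL : LipschitzWith L u) (hC : SemiconcaveOn univ C u) {Ω : Set (E n)} {η : ℝ} (hη : 0 ≤ η)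
    (hu : IsViscositySubsolution s Ω u (fun _ => η)) {x : E n} {A : Matrix (Fin n) (Fin n) ℝ}
    (hA : A ∈ unimodular n) {r : ℝ} (hr : 0 < r) (hr1 : r ≤ 1) (hball : Metric.ball x r ⊆ Ω) :
    ENNReal.ofReal η + ∫⁻ y in (Metric.ball 0 r)ᶜ,
        ENNReal.ofReal (-(1 / 2 * (secondDiff u x y * kernel s A y))) ≤
      (∫⁻ y in Metric.ball 0 r,
        ENNReal.ofReal (1 / 2 * (modulus (C + 2) (C + 2) ‖y‖ * kernel s A y))) +
      ∫⁻ y, ENNReal.ofReal (1 / 2 * (secondDiff u x y * kernel s A y)) := by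
  classical
  have hC0 : 0 ≤ C := hC.2.1
  obtain ⟨l, hl⟩ := hC.exists_paraboloid x
  -- The extra `1` in the coefficient makes the contact strict away from `x`, as the viscosity
  -- definition demands.
  set ψ : E n → ℝ := fun z => u x + l (z - x) + (C / 2 + 1) * ‖z - x‖ ^ 2 with hψ
  have hψx : ψ x = u x := by simp [hψ]
  have hψu : ∀ y, y ≠ x → u y < ψ y := by
    intro y hy
    have h1 := hl (y - x)
    rw [add_sub_cancel] at h1
    have h2 : 0 < ‖y - x‖ := norm_pos_iff.2 (sub_ne_zero.2 hy)
    have h3 : 0 < ‖y - x‖ ^ 2 := by positivity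
    simp only [hψ]
    linarith
  have hψC : ContDiff ℝ 2 ψ := by
    have h1 : ContDiff ℝ 2 fun z : E n => ‖z - x‖ ^ 2 := (contDiff_id.sub contDiff_const).norm_sq ℝ
    have h2 : ContDiff ℝ 2 fun z : E n => l (z - x) :=
      l.contDiff.comp (contDiff_id.sub contDiff_const)
    exact (contDiff_const.add h2).add (contDiff_const.mul h1)
  have hxb : x ∈ Metric.ball x r := Metric.mem_ball_self hr
  have key := hu.2 x (hball hxb) (Metric.ball x r) Metric.isOpen_ball hxb hball ψ
    hψC.contDiffOn hψx (fun y _ => hψu y)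
  have key2 := key.trans (iInf₂_le A hA)
  -- The linear part cancels and leaves `(C+2)‖y‖²`. As `r ≤ 1`, this is also the minimum defining
  -- `modulus (C + 2) (C + 2)`, whose integrability is already known.
  have hin : ∀ y, y ∈ Metric.ball (0 : E n) r →
      secondDiff ((Metric.ball x r).piecewise ψ u) x y = modulus (C + 2) (C + 2) ‖y‖ := by
    intro y hy
    rw [mem_ball_zero_iff] at hy
    have h1 : x + y ∈ Metric.ball x r := by simpa using hy
    have h2 : x - y ∈ Metric.ball x r := by simpa [Metric.mem_ball, dist_eq_norm] using hy
    rw [secondDiff, piecewise_eq_of_mem _ _ _ h1, piecewise_eq_of_mem _ _ _ h2,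
      piecewise_eq_of_mem _ _ _ hxb, hψx, modulus, abs_norm, min_eq_right]
    · simp only [hψ, add_sub_cancel_left, sub_sub_cancel_left, norm_neg, map_neg]
      ring
    · have h3 : ‖y‖ * ‖y‖ ≤ 2 * ‖y‖ := mul_le_mul_of_nonneg_right (by linarith) (norm_nonneg y)
      nlinarith
  have hout : ∀ y, y ∉ Metric.ball (0 : E n) r →
      secondDiff ((Metric.ball x r).piecewise ψ u) x y = secondDiff u x y := by
    intro y hy
    rw [mem_ball_zero_iff] at hy
    have h1 : x + y ∉ Metric.ball x r := by simpa using hy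
    have h2 : x - y ∉ Metric.ball x r := by simpa [Metric.mem_ball, dist_eq_norm] using hy
    rw [secondDiff, piecewise_eq_of_notMem _ _ _ h1, piecewise_eq_of_notMem _ _ _ h2,
      piecewise_eq_of_mem _ _ _ hxb, hψx, secondDiff]
  have hucont : Continuous u := hL.continuous
  set v := (Metric.ball x r).piecewise ψ u
  set P := ∫⁻ y, ENNReal.ofReal (1 / 2 * (secondDiff u x y * kernel s A y))
  set Q := ∫⁻ y in Metric.ball 0 r,
        ENNReal.ofReal (1 / 2 * (modulus (C + 2) (C + 2) ‖y‖ * kernel s A y))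
  have hpos : ∫⁻ y, ENNReal.ofReal (1 / 2 * (secondDiff v x y * kernel s A y)) ≤ Q + P := by
    rw [← lintegral_add_compl _ (measurableSet_ball (x := (0 : E n)) (ε := r))]
    refine add_le_add (le_of_eq ?_) (le_trans (le_of_eq ?_)
      (setLIntegral_le_lintegral (Metric.ball (0 : E n) r)ᶜ _))
    · refine setLIntegral_congr_fun measurableSet_ball fun y hy => ?_
      rw [hin y hy]
    · refine setLIntegral_congr_fun measurableSet_ball.compl fun y hy => ?_
      rw [hout y hy]
  have hneg : ∫⁻ y in (Metric.ball 0 r)ᶜ,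
        ENNReal.ofReal (-(1 / 2 * (secondDiff u x y * kernel s A y))) ≤
      ∫⁻ y, ENNReal.ofReal (-(1 / 2 * (secondDiff v x y * kernel s A y))) := by
    refine le_trans (le_of_eq ?_) (setLIntegral_le_lintegral (Metric.ball (0 : E n) r)ᶜ _)
    refine setLIntegral_congr_fun measurableSet_ball.compl fun y hy => ?_
    rw [hout y hy]
  refine le_trans ?_ ((ofReal_add_le_of_coe_le_sub hη key2).trans hpos)
  exact add_le_add le_rfl hneg

/-- A viscosity subsolution which is Lipschitz and semiconcave is a classical one: the integrals
converge at every point and satisfy the inequality. -/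
theorem IsViscositySubsolution.integrable_and_le (hn : 1 ≤ n) (hs : 1 / 2 < s) (hs' : s < 1)
    (hL : LipschitzWith L u) (hC : SemiconcaveOn univ C u) {Ω : Set (E n)} (hΩ : IsOpen Ω)
    {η : ℝ} (hη : 0 ≤ η) (hu : IsViscositySubsolution s Ω u (fun _ => η)) {x : E n} (hx : x ∈ Ω)
    {A : Matrix (Fin n) (Fin n) ℝ} (hA : A ∈ unimodular n) :
    Integrable (fun y => secondDiff u x y * kernel s A y) ∧
      η ≤ 1 / 2 * ∫ y, secondDiff u x y * kernel s A y := by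
  have hC0 : 0 ≤ C := hC.2.1
  have hucont : Continuous u := hL.continuous
  obtain ⟨r₀, hr₀, hball⟩ := Metric.isOpen_iff.1 hΩ x hx
  set r : ℕ → ℝ := fun k => min r₀ 1 * (1 / ((k : ℝ) + 1)) with hrdef
  have hm : 0 < min r₀ 1 := lt_min hr₀ one_pos
  have hrpos : ∀ k, 0 < r k := fun k => by simp only [hrdef]; positivity
  have hanti : Antitone r := fun i j hij =>
    mul_le_mul_of_nonneg_left (Nat.one_div_le_one_div hij) hm.le
  have hr0 : r 0 = min r₀ 1 := by simp [hrdef]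
  have hlim : Tendsto r atTop (𝓝 0) := by
    rw [← mul_zero (min r₀ 1)]
    exact tendsto_one_div_add_atTop_nhds_zero_nat.const_mul (min r₀ 1)
  have hle : ∀ k, r k ≤ min r₀ 1 := fun k => hr0 ▸ hanti (Nat.zero_le k)
  set P := ∫⁻ y, ENNReal.ofReal (1 / 2 * (secondDiff u x y * kernel s A y)) with hP
  set N := ∫⁻ y, ENNReal.ofReal (-(1 / 2 * (secondDiff u x y * kernel s A y))) with hN
  set Q : E n → ENNReal := fun y =>
    ENNReal.ofReal (1 / 2 * (modulus (C + 2) (C + 2) ‖y‖ * kernel s A y)) with hQ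
  have hQfin : ∫⁻ y, Q y ≠ ⊤ :=
    ((integrable_modulus_kernel hn (by linarith) (by linarith) hs hs' hA).const_mul
      (1 / 2)).lintegral_lt_top.ne
  have hPfin : P ≠ ⊤ := by
    refine ne_top_of_le_ne_top ((integrable_modulus_kernel hn L.coe_nonneg hC0 hs hs' hA).const_mul
      (1 / 2)).lintegral_lt_top.ne (lintegral_mono fun y => ENNReal.ofReal_le_ofReal ?_)
    exact mul_le_mul_of_nonneg_left (mul_le_mul_of_nonneg_right (secondDiff_le_modulus hL hC x y)
      (kernel_nonneg s A y)) (by norm_num)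
  have hstep : ∀ k, ENNReal.ofReal η + ∫⁻ y in (Metric.ball 0 (r k))ᶜ,
        ENNReal.ofReal (-(1 / 2 * (secondDiff u x y * kernel s A y))) ≤
      (∫⁻ y in Metric.ball 0 (r k), Q y) + P := fun k =>
    hu.add_lintegral_neg_le hL hC hη hA (hrpos k) ((hle k).trans (min_le_right _ _))
      ((Metric.ball_subset_ball ((hle k).trans (min_le_left _ _))).trans hball)
  -- The paraboloid contributes a fixed integrable function over shrinking balls, hence nothing in
  -- the limit.
  have hQlim : Tendsto (fun k => ∫⁻ y in Metric.ball 0 (r k), Q y) atTop (𝓝 0) := by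
    refine tendsto_setLIntegral_zero hQfin ?_
    have : Nonempty (Fin n) := ⟨⟨0, hn⟩⟩
    have h1 : ∀ k, (volume : Measure (E n)) (Metric.ball 0 (r k)) =
        ENNReal.ofReal (r k ^ n) * volume (Metric.ball (0 : E n) 1) := fun k => by
      rw [Measure.addHaar_ball _ _ (hrpos k).le]; simp
    refine Tendsto.congr (fun k => (h1 k).symm) ?_
    have h2 : Tendsto (fun k => ENNReal.ofReal (r k ^ n)) atTop (𝓝 0) := by
      have := (ENNReal.continuous_ofReal.tendsto _).comp (hlim.pow n)
      simpa [Function.comp_def, (show n ≠ 0 by omega)] using this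
    simpa using ENNReal.Tendsto.mul_const h2 (Or.inr measure_ball_lt_top.ne)
  have hmain : ENNReal.ofReal η + N ≤ P := by
    have h1 := (tendsto_setLIntegral_compl_ball hn
      (F := fun y => ENNReal.ofReal (-(1 / 2 * (secondDiff u x y * kernel s A y))))
      hanti hlim).const_add (ENNReal.ofReal η)
    have h2 := hQlim.add_const P
    rw [zero_add] at h2
    exact le_of_tendsto_of_tendsto' h1 h2 hstep
  -- Finiteness of the negative part is a consequence of the limiting inequality: it is dominated by
  -- the positive part, which the modulus controls.
  have hNfin : N ≠ ⊤ := ne_top_of_le_ne_top hPfin (le_trans le_add_self hmain)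
  have hint : Integrable fun y => 1 / 2 * (secondDiff u x y * kernel s A y) := by
    refine ⟨by fun_prop, ?_⟩
    rw [hasFiniteIntegral_iff_norm]
    have h1 : ∀ y, ENNReal.ofReal ‖1 / 2 * (secondDiff u x y * kernel s A y)‖ =
        ENNReal.ofReal (1 / 2 * (secondDiff u x y * kernel s A y)) +
          ENNReal.ofReal (-(1 / 2 * (secondDiff u x y * kernel s A y))) := by
      intro y
      generalize 1 / 2 * (secondDiff u x y * kernel s A y) = a
      rcases le_total 0 a with h | h
      · rw [Real.norm_of_nonneg h, ENNReal.ofReal_of_nonpos (neg_nonpos.2 h), add_zero]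
      · rw [Real.norm_of_nonpos h, ENNReal.ofReal_of_nonpos h, zero_add]
    simp_rw [h1]
    rw [lintegral_add_left (by fun_prop)]
    exact ENNReal.add_lt_top.2 ⟨hPfin.lt_top, hNfin.lt_top⟩
  refine ⟨?_, ?_⟩
  · have := hint.const_mul 2
    simpa [← mul_assoc] using this
  · rw [← integral_const_mul, integral_eq_lintegral_pos_part_sub_lintegral_neg_part hint]
    have h1 := ENNReal.toReal_mono hPfin hmain
    rw [ENNReal.toReal_add ENNReal.ofReal_ne_top hNfin, ENNReal.toReal_ofReal hη] at h1
    linarith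

end FracMA

end

/-! ### Marginals of the stretched kernel -/

noncomputable section

namespace FracMA

/-- The value of `∫_0^∞ r^k (1 + r²)^{-p} dr`. -/
def betaConst (k p : ℝ) : ℝ :=
  Real.Gamma ((k + 1) / 2) * Real.Gamma (p - (k + 1) / 2) / (2 * Real.Gamma p)

theorem scaled_beta_eq {a b r : ℝ} (ha : 0 < a) (hb : 0 < b) (hr : 0 < r) (k p : ℝ) :
    r ^ k * (a ^ 2 + (r * b) ^ 2) ^ (-p) =
      a ^ (k - 2 * p) * b ^ (-k) * ((b / a * r) ^ k * (1 + (b / a * r) ^ 2) ^ (-p)) := by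
  have h1 : a ^ 2 + (r * b) ^ 2 = a ^ 2 * (1 + (b / a * r) ^ 2) := by
    field_simp
  have h2 : (a ^ 2) ^ (-p) = a ^ (-(2 * p)) := by
    rw [← Real.rpow_natCast, ← Real.rpow_mul ha.le]
    congr 1
    push_cast
    ring
  rw [h1, Real.mul_rpow (by positivity) (by positivity), h2,
    Real.mul_rpow (by positivity) hr.le, Real.div_rpow hb.le ha.le, Real.rpow_neg hb.le,
    sub_eq_add_neg, Real.rpow_add ha]
  have : 0 < a ^ k := by positivity
  have : 0 < b ^ k := by positivity
  field_simp

theorem integrableOn_scaled_beta {a b : ℝ} (ha : 0 < a) (hb : 0 < b) {k p : ℝ} (hk : -1 < k)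
    (hp : k + 1 < 2 * p) :
    IntegrableOn (fun r : ℝ => r ^ k * (a ^ 2 + (r * b) ^ 2) ^ (-p)) (Ioi 0) := by
  have h := (integrableOn_Ioi_comp_mul_left_iff
    (fun r : ℝ => r ^ k * (1 + r ^ 2) ^ (-p)) 0 (div_pos hb ha)).2
    (by simpa using integrableOn_rpow_mul_one_add_sq_rpow hk hp)
  refine (integrableOn_congr_fun (fun r hr => ?_) measurableSet_Ioi).1
    (h.const_mul (a ^ (k - 2 * p) * b ^ (-k)))
  exact (scaled_beta_eq ha hb hr k p).symm

theorem integral_scaled_beta {a b : ℝ} (ha : 0 < a) (hb : 0 < b) {k p : ℝ} (hk : -1 < k)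
    (hp : k + 1 < 2 * p) :
    ∫ r in Ioi (0 : ℝ), r ^ k * (a ^ 2 + (r * b) ^ 2) ^ (-p) =
      a ^ (k + 1 - 2 * p) * b ^ (-(k + 1)) * betaConst k p := by
  rw [setIntegral_congr_fun measurableSet_Ioi fun r hr => scaled_beta_eq ha hb hr k p,
    integral_const_mul, integral_comp_mul_left_Ioi
    (fun r : ℝ => r ^ k * (1 + r ^ 2) ^ (-p)) 0 (div_pos hb ha), mul_zero,
    integral_rpow_mul_one_add_sq_rpow hk hp, betaConst,
    show k + 1 - 2 * p = (k - 2 * p) + 1 by ring, neg_add, Real.rpow_add ha, Real.rpow_add hb,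
    Real.rpow_one, Real.rpow_neg_one, smul_eq_mul, inv_div]
  ring

/-- The kernel of a stretched operator in the coordinates `(t, |w|)` adapted to the axis. -/
def axisKernel (M ε p t r : ℝ) : ℝ := ((t / M) ^ 2 + (r / ε) ^ 2) ^ (-p)

theorem axisKernel_nonneg (M ε p t r : ℝ) : 0 ≤ axisKernel M ε p t r := by
  unfold axisKernel; positivity

variable {n : ℕ} {s M ε : ℝ}

theorem integrable_axisKernel_line (hn : 2 ≤ n) (hs : 0 < s) (hM : 0 < M) (hε : 0 < ε) {r : ℝ}
    (hr : 0 < r) : Integrable fun t => axisKernel M ε (((n : ℝ) + 2 * s) / 2) t r := by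
  have hn' : (2 : ℝ) ≤ n := by exact_mod_cast hn
  have h := (integrable_fun_norm_addHaar (volume : Measure ℝ)
    (f := fun t => axisKernel M ε (((n : ℝ) + 2 * s) / 2) t r)).2 ?_
  · simpa [axisKernel, div_pow] using h
  · have := integrableOn_scaled_beta (div_pos hr hε) (inv_pos.2 hM) (k := 0)
      (p := ((n : ℝ) + 2 * s) / 2) (by norm_num) (by linarith)
    simpa [axisKernel, div_eq_mul_inv, add_comm] using this

/-- Scaling reduces this to the beta integral with `k = 0`; the determinant condition collapses `M
ε^(n-1+2s)` to `ε^(2s)`. This marginal produces the first factor of `const₁`. -/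
theorem integral_axisKernel_line (hn : 2 ≤ n) (hs : 0 < s) (hM : 0 < M) (hε : 0 < ε)
    (h : M * ε ^ (n - 1) = 1) {r : ℝ} (hr : 0 < r) :
    ∫ t, axisKernel M ε (((n : ℝ) + 2 * s) / 2) t r =
      √Real.pi * Real.Gamma (((n : ℝ) - 1) / 2 + s) / Real.Gamma ((n : ℝ) / 2 + s) *
        ε ^ (2 * s) * (r ^ (((n - 1 : ℕ) : ℝ) + 2 * s))⁻¹ := by
  have hn' : (2 : ℝ) ≤ n := by exact_mod_cast hn
  have h1 := integral_comp_abs (f := fun t => axisKernel M ε (((n : ℝ) + 2 * s) / 2) t r)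
  simp only [axisKernel, div_pow, sq_abs] at h1
  have h2 := integral_scaled_beta (div_pos hr hε) (inv_pos.2 hM) (k := 0)
      (p := ((n : ℝ) + 2 * s) / 2) (by norm_num) (by linarith)
  have hcast : ((n - 1 : ℕ) : ℝ) = (n : ℝ) - 1 := by
    rw [Nat.cast_sub (by omega), Nat.cast_one]
  have hMε : M = ε ^ (1 - (n : ℝ)) := by
    rw [← neg_sub, Real.rpow_neg hε.le, ← hcast, Real.rpow_natCast]
    exact eq_inv_of_mul_eq_one_left h
  simp only [Real.rpow_zero, one_mul, zero_add] at h2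
  simp only [axisKernel, div_pow]
  rw [h1]
  have h3 : ∫ x in Ioi (0 : ℝ), (x ^ 2 / M ^ 2 + r ^ 2 / ε ^ 2) ^ (-(((n : ℝ) + 2 * s) / 2)) =
      ∫ x in Ioi (0 : ℝ), ((r / ε) ^ 2 + (x * M⁻¹) ^ 2) ^ (-(((n : ℝ) + 2 * s) / 2)) := by
    simp only [div_eq_mul_inv, mul_pow, inv_pow, add_comm]
  rw [h3, h2, hcast, Real.rpow_neg_one, inv_inv, Real.div_rpow hr.le hε.le, betaConst,
    show (1 : ℝ) - 2 * (((n : ℝ) + 2 * s) / 2) = -((n : ℝ) - 1 + 2 * s) by ring,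
    Real.rpow_neg hr.le, Real.rpow_neg hε.le,
    show (((n : ℝ) + 2 * s) / 2) - (0 + 1) / 2 = ((n : ℝ) - 1) / 2 + s by ring,
    show ((n : ℝ) + 2 * s) / 2 = (n : ℝ) / 2 + s by ring, zero_add, Real.Gamma_one_half_eq,
    div_inv_eq_mul]
  have h4 : ε ^ ((n : ℝ) - 1 + 2 * s) * M = ε ^ (2 * s) := by
    rw [hMε, ← Real.rpow_add hε]
    congr 1
    ring
  have hG : 0 < Real.Gamma ((n : ℝ) / 2 + s) := Real.Gamma_pos_of_pos (by linarith)
  rw [← h4]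
  field_simp

theorem integrable_axisKernel_perp (hn : 2 ≤ n) (hs : 0 < s) (hM : 0 < M) (hε : 0 < ε) {t : ℝ}
    (ht : t ≠ 0) :
    Integrable fun w : E (n - 1) => axisKernel M ε (((n : ℝ) + 2 * s) / 2) t ‖w‖ := by
  have hn' : (2 : ℝ) ≤ n := by exact_mod_cast hn
  have : Nonempty (Fin (n - 1)) := ⟨⟨0, by omega⟩⟩
  have hcast : ((n - 1 - 1 : ℕ) : ℝ) = (n : ℝ) - 2 := by
    rw [Nat.cast_sub (by omega), Nat.cast_sub (by omega)]
    push_cast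
    ring
  refine (integrable_fun_norm_addHaar (volume : Measure (E (n - 1)))
    (f := fun r => axisKernel M ε (((n : ℝ) + 2 * s) / 2) t r)).2 ?_
  have := integrableOn_scaled_beta (div_pos (abs_pos.2 ht) hM) (inv_pos.2 hε)
      (k := ((n - 1 - 1 : ℕ) : ℝ)) (p := ((n : ℝ) + 2 * s) / 2)
      (by rw [hcast]; linarith) (by rw [hcast]; linarith)
  simpa [axisKernel, div_eq_mul_inv, mul_pow] using this

/-- Polar coordinates in dimension `n - 1` give the beta integral with `k = n - 2`, and `ε^(n-1) =
M⁻¹` leaves the power `M^(2s)`. -/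
theorem integral_axisKernel_perp (hn : 2 ≤ n) (hs : 0 < s) (hM : 0 < M) (hε : 0 < ε)
    (h : M * ε ^ (n - 1) = 1) {t : ℝ} (ht : t ≠ 0) :
    ∫ w : E (n - 1), axisKernel M ε (((n : ℝ) + 2 * s) / 2) t ‖w‖ =
      const₂ n s * M ^ (2 * s) * (|t| ^ (1 + 2 * s))⁻¹ := by
  have hn' : (2 : ℝ) ≤ n := by exact_mod_cast hn
  have : Nonempty (Fin (n - 1)) := ⟨⟨0, by omega⟩⟩
  have ht' : 0 < |t| := abs_pos.2 ht
  have hcast : ((n - 1 - 1 : ℕ) : ℝ) = (n : ℝ) - 2 := by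
    rw [Nat.cast_sub (by omega), Nat.cast_sub (by omega)]
    push_cast
    ring
  have h2 := integral_scaled_beta (div_pos ht' hM) (inv_pos.2 hε)
      (k := ((n - 1 - 1 : ℕ) : ℝ)) (p := ((n : ℝ) + 2 * s) / 2)
      (by rw [hcast]; linarith) (by rw [hcast]; linarith)
  have h3 : ∫ r in Ioi (0 : ℝ), r ^ (n - 1 - 1) * axisKernel M ε (((n : ℝ) + 2 * s) / 2) t r =
      ∫ r in Ioi (0 : ℝ), r ^ ((n - 1 - 1 : ℕ) : ℝ) *
        ((|t| / M) ^ 2 + (r * ε⁻¹) ^ 2) ^ (-(((n : ℝ) + 2 * s) / 2)) := by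
    simp only [axisKernel, div_eq_mul_inv, mul_pow, sq_abs, Real.rpow_natCast]
  rw [integral_radial, finrank_euclideanSpace_fin, h3, h2, hcast, betaConst, const₂,
    show (n : ℝ) - 2 + 1 - 2 * (((n : ℝ) + 2 * s) / 2) = -(1 + 2 * s) by ring,
    Real.rpow_neg (by positivity), Real.div_rpow ht'.le hM.le, Real.inv_rpow hε.le,
    Real.rpow_neg hε.le, inv_inv, show (n : ℝ) - 2 + 1 = ((n - 1 : ℕ) : ℝ) by
      rw [Nat.cast_sub (by omega)]; push_cast; ring, Real.rpow_natCast, Real.rpow_add hM,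
    Real.rpow_one, eq_inv_of_mul_eq_one_right h,
    show ((n : ℝ) + 2 * s) / 2 - ((n - 1 : ℕ) : ℝ) / 2 = s + 1 / 2 by
      rw [Nat.cast_sub (by omega)]; push_cast; ring,
    show ((n - 1 : ℕ) : ℝ) = (n : ℝ) - 1 by rw [Nat.cast_sub (by omega)]; push_cast; ring,
    show ((n : ℝ) + 2 * s) / 2 = (n : ℝ) / 2 + s by ring]
  field_simp

@[fun_prop]
theorem measurable_axisKernel (M ε p : ℝ) :
    Measurable fun z : ℝ × E n => axisKernel M ε p z.1 ‖z.2‖ := by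
  unfold axisKernel; fun_prop

theorem const₂_pos (hn : 2 ≤ n) (hs : 0 < s) : 0 < const₂ n s := by
  have hn' : (2 : ℝ) ≤ n := by exact_mod_cast hn
  have h1 := sphereArea_pos (show 0 < n - 1 by omega)
  have h2 : 0 < Real.Gamma (((n : ℝ) - 1) / 2) := Real.Gamma_pos_of_pos (by linarith)
  have h3 : 0 < Real.Gamma (s + 1 / 2) := Real.Gamma_pos_of_pos (by linarith)
  have h4 : 0 < Real.Gamma ((n : ℝ) / 2 + s) := Real.Gamma_pos_of_pos (by linarith)
  unfold const₂
  positivity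

/-- Both directions serve: one makes the modulus along the axis integrable on the product, the other
brings convergence back from the product to the line. -/
theorem integrable_mul_axisKernel_iff (hn : 2 ≤ n) (hs : 0 < s) (hM : 0 < M) (hε : 0 < ε)
    (h : M * ε ^ (n - 1) = 1) {f : ℝ → ℝ} (hf : Measurable f) :
    Integrable (fun z : ℝ × E (n - 1) => f z.1 * axisKernel M ε (((n : ℝ) + 2 * s) / 2) z.1 ‖z.2‖)
      (volume.prod volume) ↔ Integrable fun t => f t / |t| ^ (1 + 2 * s) := by
  have hM' : 0 < M ^ (2 * s) := by positivity
  have hC2 := const₂_pos hn hs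
  have hne : ∀ᵐ t : ℝ, t ≠ 0 := by simp [ae_iff]
  rw [integrable_prod_iff (by fun_prop)]
  have h1 : ∀ᵐ t : ℝ, Integrable
      (fun w : E (n - 1) => f t * axisKernel M ε (((n : ℝ) + 2 * s) / 2) t ‖w‖) := by
    filter_upwards [hne] with t ht
    exact (integrable_axisKernel_perp hn hs hM hε ht).const_mul _
  have h2 : (fun t => ∫ w : E (n - 1), ‖f t * axisKernel M ε (((n : ℝ) + 2 * s) / 2) t ‖w‖‖)
      =ᵐ[volume] fun t => (const₂ n s * M ^ (2 * s)) * ‖f t / |t| ^ (1 + 2 * s)‖ := by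
    filter_upwards [hne] with t ht
    simp_rw [norm_mul, Real.norm_of_nonneg (axisKernel_nonneg _ _ _ _ _)]
    rw [integral_const_mul, integral_axisKernel_perp hn hs hM hε h ht, norm_div,
      Real.norm_of_nonneg (by positivity : 0 ≤ |t| ^ (1 + 2 * s))]
    ring
  rw [integrable_congr h2]
  have h3 : AEStronglyMeasurable (fun t => f t / |t| ^ (1 + 2 * s)) volume :=
    (by fun_prop : Measurable fun t => f t / |t| ^ (1 + 2 * s)).aestronglyMeasurable
  refine ⟨fun hh => ?_, fun hh => ⟨h1, (hh.norm).const_mul _⟩⟩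
  rw [← integrable_norm_iff h3]
  exact (integrable_const_mul_iff (mul_pos hC2 hM').ne'.isUnit _).1 hh.2

theorem integral_mul_axisKernel (hn : 2 ≤ n) (hs : 0 < s) (hM : 0 < M) (hε : 0 < ε)
    (h : M * ε ^ (n - 1) = 1) {f : ℝ → ℝ} (hf : Measurable f)
    (hfi : Integrable fun t => f t / |t| ^ (1 + 2 * s)) :
    ∫ z : ℝ × E (n - 1), f z.1 * axisKernel M ε (((n : ℝ) + 2 * s) / 2) z.1 ‖z.2‖
      ∂(volume.prod volume) = const₂ n s * M ^ (2 * s) * ∫ t, f t / |t| ^ (1 + 2 * s) := by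
  rw [integral_prod _ ((integrable_mul_axisKernel_iff hn hs hM hε h hf).2 hfi),
    ← integral_const_mul]
  refine integral_congr_ae ?_
  filter_upwards [show ∀ᵐ t : ℝ, t ≠ 0 by simp [ae_iff]] with t ht
  rw [integral_const_mul, integral_axisKernel_perp hn hs hM hε h ht]
  ring

theorem integrable_norm_mul_axisKernel (hn : 2 ≤ n) (hs : 0 < s) (hM : 0 < M) (hε : 0 < ε)
    (h : M * ε ^ (n - 1) = 1) {g : ℝ → ℝ} (hg : Measurable g)
    (hgi : Integrable fun w : E (n - 1) => g ‖w‖ * (‖w‖ ^ (((n - 1 : ℕ) : ℝ) + 2 * s))⁻¹) :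
    Integrable (fun z : ℝ × E (n - 1) =>
      g ‖z.2‖ * axisKernel M ε (((n : ℝ) + 2 * s) / 2) z.1 ‖z.2‖) (volume.prod volume) := by
  have : Nonempty (Fin (n - 1)) := ⟨⟨0, by omega⟩⟩
  have hne : ∀ᵐ w : E (n - 1), w ≠ 0 := by simp [ae_iff]
  rw [integrable_prod_iff' (by fun_prop)]
  refine ⟨?_, ?_⟩
  · filter_upwards [hne] with w hw
    exact (integrable_axisKernel_line hn hs hM hε (norm_pos_iff.2 hw)).const_mul _
  · refine (integrable_congr ?_).1 (hgi.norm.const_mul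
      (√Real.pi * Real.Gamma (((n : ℝ) - 1) / 2 + s) / Real.Gamma ((n : ℝ) / 2 + s) *
        ε ^ (2 * s)))
    filter_upwards [hne] with w hw
    simp_rw [norm_mul, Real.norm_of_nonneg (axisKernel_nonneg _ _ _ _ _)]
    rw [integral_const_mul, integral_axisKernel_line hn hs hM hε h (norm_pos_iff.2 hw),
      Real.norm_of_nonneg (by positivity : 0 ≤ (‖w‖ ^ (((n - 1 : ℕ) : ℝ) + 2 * s))⁻¹)]
    ring

theorem integral_norm_mul_axisKernel (hn : 2 ≤ n) (hs : 0 < s) (hM : 0 < M) (hε : 0 < ε)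
    (h : M * ε ^ (n - 1) = 1) {g : ℝ → ℝ} (hg : Measurable g)
    (hgi : Integrable fun w : E (n - 1) => g ‖w‖ * (‖w‖ ^ (((n - 1 : ℕ) : ℝ) + 2 * s))⁻¹) :
    ∫ z : ℝ × E (n - 1), g ‖z.2‖ * axisKernel M ε (((n : ℝ) + 2 * s) / 2) z.1 ‖z.2‖
      ∂(volume.prod volume) =
    √Real.pi * Real.Gamma (((n : ℝ) - 1) / 2 + s) / Real.Gamma ((n : ℝ) / 2 + s) * ε ^ (2 * s) *
      ∫ w : E (n - 1), g ‖w‖ * (‖w‖ ^ (((n - 1 : ℕ) : ℝ) + 2 * s))⁻¹ := by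
  have : Nonempty (Fin (n - 1)) := ⟨⟨0, by omega⟩⟩
  rw [integral_prod_symm _ (integrable_norm_mul_axisKernel hn hs hM hε h hg hgi),
    ← integral_const_mul]
  refine integral_congr_ae ?_
  filter_upwards [show ∀ᵐ w : E (n - 1), w ≠ 0 by simp [ae_iff]] with w hw
  rw [integral_const_mul, integral_axisKernel_line hn hs hM hε h (norm_pos_iff.2 hw)]
  ring

end FracMA

end

/-! ### Bounding a stretched operator by the operator on its axis -/

noncomputable section

namespace FracMA

variable {n : ℕ} {s M ε : ℝ}

theorem exists_isometry_orthogonal (hn : 1 ≤ n) {e : E n} (he : ‖e‖ = 1) :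
    ∃ T : E (n - 1) →ₗᵢ[ℝ] E n, ∀ w, inner ℝ e (T w) = 0 := by
  obtain ⟨m, rfl⟩ : ∃ m, n = m + 1 := ⟨n - 1, by omega⟩
  have : Fact (Module.finrank ℝ (E (m + 1)) = m + 1) := ⟨by simp⟩
  have he0 : e ≠ 0 := by
    rintro rfl
    simp at he
  let b := OrthonormalBasis.fromOrthogonalSpanSingleton (𝕜 := ℝ) m he0
  refine ⟨(Submodule.subtypeₗᵢ _).comp b.repr.symm.toLinearIsometry, fun w => ?_⟩
  exact Submodule.mem_orthogonal_singleton_iff_inner_right.1 (b.repr.symm w).2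

theorem norm_sq_smul_add {e : E n} (he : ‖e‖ = 1) {T : E (n - 1) →ₗᵢ[ℝ] E n}
    (hT : ∀ w, inner ℝ e (T w) = 0) (t : ℝ) (w : E (n - 1)) :
    ‖t • e + T w‖ ^ 2 = t ^ 2 + ‖w‖ ^ 2 := by
  rw [norm_add_sq_real, inner_smul_left, hT, norm_smul, he, T.norm_map]
  simp

theorem measurePreserving_smul_add (hn : 1 ≤ n) {e : E n} (he : ‖e‖ = 1)
    {T : E (n - 1) →ₗᵢ[ℝ] E n} (hT : ∀ w, inner ℝ e (T w) = 0) :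
    MeasurePreserving (fun z : ℝ × E (n - 1) => z.1 • e + T z.2)
      ((volume : Measure ℝ).prod volume) volume := by
  -- The sup norm on the product would not make the coordinate map an isometry; the `L²` product
  -- norm does.
  let f : WithLp 2 (ℝ × E (n - 1)) →ₗ[ℝ] E n :=
    { toFun := fun z => z.fst • e + T z.snd
      map_add' := fun a b => by simp only [WithLp.add_fst, WithLp.add_snd, map_add]; module
      map_smul' := fun c a => by
        simp only [WithLp.smul_fst, WithLp.smul_snd, map_smul, RingHom.id_apply]; module }
  let F : WithLp 2 (ℝ × E (n - 1)) →ₗᵢ[ℝ] E n :=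
    { f with
      norm_map' := fun z => by
        rw [← sq_eq_sq₀ (norm_nonneg _) (norm_nonneg _), WithLp.prod_norm_sq_eq_of_L2]
        exact (norm_sq_smul_add he hT _ _).trans (by simp) }
  have hrank : Module.finrank ℝ (WithLp 2 (ℝ × E (n - 1))) = Module.finrank ℝ (E n) := by
    rw [(WithLp.linearEquiv 2 ℝ (ℝ × E (n - 1))).finrank_eq, Module.finrank_prod]
    simp
    omega
  exact (F.toLinearIsometryEquiv hrank).measurePreserving.comp
    (WithLp.volume_preserving_toLp ℝ (E (n - 1)))

theorem kernel_stretch {e : E n} (he : ‖e‖ = 1) {T : E (n - 1) →ₗᵢ[ℝ] E n}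
    (hT : ∀ w, inner ℝ e (T w) = 0) (hM : 0 < M) (hε : 0 < ε) (t : ℝ) (w : E (n - 1)) :
    kernel s (stretch e M ε) (t • e + T w) =
      axisKernel M ε (((n : ℝ) + 2 * s) / 2) t ‖w‖ := by
  have h1 : Matrix.toEuclideanCLM (𝕜 := ℝ) (stretch e M ε)⁻¹ (t • e + T w) =
      (t / M) • e + T (ε⁻¹ • w) := by
    rw [stretch_inv he hM.ne' hε.ne', clm_stretch, inner_add_right, inner_smul_right, hT,
      real_inner_self_eq_norm_sq, he, map_smul]
    module
  rw [kernel, h1, axisKernel, Real.rpow_neg (by positivity)]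
  congr 1
  rw [show (t / M) ^ 2 + (‖w‖ / ε) ^ 2 = ‖(t / M) • e + T (ε⁻¹ • w)‖ ^ 2 by
    rw [norm_sq_smul_add he hT, norm_smul, norm_inv, Real.norm_of_nonneg hε.le]; ring,
    ← Real.rpow_natCast, ← Real.rpow_mul (norm_nonneg _)]
  congr 1
  push_cast
  ring

variable {u : E n → ℝ} {L : ℝ≥0} {C : ℝ}

/-- The left side regroups into second differences in direction `b` based at `x + a` and `x - a`,
each bounded by the modulus. -/
theorem secondDiff_add_secondDiff_le (hL : LipschitzWith L u) (hC : SemiconcaveOn univ C u)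
    (x a b : E n) :
    1 / 2 * (secondDiff u x (a + b) + secondDiff u x (a - b)) ≤
      secondDiff u x a + modulus L C ‖b‖ := by
  have h1 := secondDiff_le_modulus hL hC (x + a) b
  have h2 := secondDiff_le_modulus hL hC (x - a) b
  unfold secondDiff at *
  rw [show x + (a + b) = x + a + b by abel, show x - (a + b) = x - a - b by abel,
    show x + (a - b) = x + a - b by abel, show x - (a - b) = x - a + b by abel]
  linarith

theorem secondDiff_smul_le (hL : LipschitzWith L u) (hC : SemiconcaveOn univ C u) (x : E n)
    {e : E n} (he : ‖e‖ = 1) (t : ℝ) :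
    secondDiff u x (t • e) ≤ modulus L C t := by
  have := secondDiff_le_modulus hL hC x (t • e)
  rwa [norm_smul, he, mul_one, Real.norm_eq_abs, modulus_abs] at this

/-- Upper bound of the operator with a matrix stretched along an axis by the one-dimensional
operator along this axis. -/
theorem integral_stretch_le (hn : 2 ≤ n) (hs : 1 / 2 < s) (hs' : s < 1)
    (hL : LipschitzWith L u) (hC : SemiconcaveOn univ C u) (x : E n) {e : E n} (he : ‖e‖ = 1)
    (hM : 0 < M) (hε : 0 < ε) (h : M * ε ^ (n - 1) = 1)
    (hint : Integrable fun y => secondDiff u x y * kernel s (stretch e M ε) y) :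
    Integrable (fun t : ℝ => secondDiff u x (t • e) / |t| ^ (1 + 2 * s)) ∧
    (1 - s) / 2 * ∫ y, secondDiff u x y * kernel s (stretch e M ε) y ≤
      const₂ n s * M ^ (2 * s) *
        ((1 - s) / 2 * ∫ t : ℝ, secondDiff u x (t • e) / |t| ^ (1 + 2 * s)) +
      const₁ n s L C * ε ^ (2 * s) := by
  have hs0 : 0 < s := by linarith
  have hC0 : 0 ≤ C := hC.2.1
  have : Nonempty (Fin (n - 1)) := ⟨⟨0, by omega⟩⟩
  have hucont : Continuous u := hL.continuous
  obtain ⟨T, hT⟩ := exists_isometry_orthogonal (by omega) he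
  have hmp := measurePreserving_smul_add (by omega) he hT
  have hmeas : Measurable fun y => secondDiff u x y * kernel s (stretch e M ε) y := by fun_prop
  set K : ℝ → ℝ → ℝ := axisKernel M ε (((n : ℝ) + 2 * s) / 2) with hK
  have hKnn : ∀ t r, 0 ≤ K t r := axisKernel_nonneg _ _ _
  have hplus : Integrable (fun z : ℝ × E (n - 1) =>
      secondDiff u x (z.1 • e + T z.2) * K z.1 ‖z.2‖) (volume.prod volume) := by
    have := (hmp.integrable_comp hmeas.aestronglyMeasurable).2 hint
    refine this.congr (ae_of_all _ fun z => ?_)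
    simp only [Function.comp_apply, kernel_stretch he hT hM hε, hK]
  have hplus_eq : ∫ z : ℝ × E (n - 1), secondDiff u x (z.1 • e + T z.2) * K z.1 ‖z.2‖
      ∂(volume.prod volume) = ∫ y, secondDiff u x y * kernel s (stretch e M ε) y := by
    rw [← hmp.map_eq, integral_map hmp.measurable.aemeasurable hmeas.aestronglyMeasurable]
    simp only [kernel_stretch he hT hM hε, hK]
  -- The kernel depends on `w` only through `‖w‖`, so replacing `w` by `-w` leaves the integral
  -- unchanged and permits symmetrization.
  have hneg : MeasurePreserving (Prod.map id Neg.neg : ℝ × E (n - 1) → ℝ × E (n - 1))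
      (volume.prod volume) (volume.prod volume) :=
    (MeasurePreserving.id _).prod (Measure.measurePreserving_neg volume)
  have hminus : Integrable (fun z : ℝ × E (n - 1) =>
      secondDiff u x (z.1 • e - T z.2) * K z.1 ‖z.2‖) (volume.prod volume) := by
    have := (hneg.integrable_comp hplus.aestronglyMeasurable).2 hplus
    refine this.congr (ae_of_all _ fun z => ?_)
    simp [sub_eq_add_neg]
  have hminus_eq : ∫ z : ℝ × E (n - 1), secondDiff u x (z.1 • e - T z.2) * K z.1 ‖z.2‖
      ∂(volume.prod volume) = ∫ y, secondDiff u x y * kernel s (stretch e M ε) y := by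
    have hp := hplus.aestronglyMeasurable
    rw [← hneg.map_eq] at hp
    rw [← hplus_eq, ← hneg.map_eq, integral_map hneg.measurable.aemeasurable hp, hneg.map_eq]
    simp [sub_eq_add_neg]
  have hmod1 : Integrable (fun z : ℝ × E (n - 1) => modulus L C z.1 * K z.1 ‖z.2‖)
      (volume.prod volume) :=
    (integrable_mul_axisKernel_iff hn hs0 hM hε h (by fun_prop)).2
      (integrable_modulus L.coe_nonneg hC0 hs hs')
  have hgi := integrable_modulus_norm (V := E (n - 1)) L.coe_nonneg hC0 hs hs' (d := n - 1) (by simp)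
  have hmod2 : Integrable (fun z : ℝ × E (n - 1) => modulus L C ‖z.2‖ * K z.1 ‖z.2‖)
      (volume.prod volume) :=
    integrable_norm_mul_axisKernel hn hs0 hM hε h (by fun_prop) hgi
  have hsym : Integrable (fun z : ℝ × E (n - 1) =>
      1 / 2 * (secondDiff u x (z.1 • e + T z.2) * K z.1 ‖z.2‖ +
        secondDiff u x (z.1 • e - T z.2) * K z.1 ‖z.2‖)) (volume.prod volume) :=
    (hplus.add hminus).const_mul (1 / 2)
  have hlow : ∀ z : ℝ × E (n - 1), 1 / 2 * (secondDiff u x (z.1 • e + T z.2) * K z.1 ‖z.2‖ +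
      secondDiff u x (z.1 • e - T z.2) * K z.1 ‖z.2‖) - modulus L C ‖z.2‖ * K z.1 ‖z.2‖ ≤
      secondDiff u x (z.1 • e) * K z.1 ‖z.2‖ := by
    intro z
    have h1 := mul_le_mul_of_nonneg_right
      (secondDiff_add_secondDiff_le hL hC x (z.1 • e) (T z.2)) (hKnn z.1 ‖z.2‖)
    rw [T.norm_map] at h1
    linarith
  have hup : ∀ z : ℝ × E (n - 1), secondDiff u x (z.1 • e) * K z.1 ‖z.2‖ ≤
      modulus L C z.1 * K z.1 ‖z.2‖ := fun z =>
    mul_le_mul_of_nonneg_right (secondDiff_smul_le hL hC x he z.1) (hKnn _ _)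
  have hfm : Measurable fun t : ℝ => secondDiff u x (t • e) := by fun_prop
  -- Convergence on the line is not assumed: the integrand is squeezed between integrable functions,
  -- the lower one coming from the assumed convergence of the full integral.
  have hline : Integrable (fun z : ℝ × E (n - 1) => secondDiff u x (z.1 • e) * K z.1 ‖z.2‖)
      (volume.prod volume) := by
    refine integrable_of_le_of_le ?_ (ae_of_all _ hlow) (ae_of_all _ hup) (hsym.sub hmod2) hmod1
    exact ((hfm.comp measurable_fst).mul (measurable_axisKernel _ _ _)).aestronglyMeasurable
  have hint1 := (integrable_mul_axisKernel_iff hn hs0 hM hε h hfm).1 hline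
  refine ⟨hint1, ?_⟩
  have hval1 := integral_mul_axisKernel hn hs0 hM hε h hfm hint1
  have hval2 := integral_norm_mul_axisKernel hn hs0 hM hε h
    (continuous_modulus L C).measurable hgi
  rw [integral_modulus_norm (V := E (n - 1)) L C hs' (d := n - 1) (by simp)] at hval2
  have hmono := integral_mono (hsym.sub hmod2) hline hlow
  simp only [Pi.sub_apply] at hmono
  rw [integral_sub hsym hmod2, integral_const_mul, integral_add hplus hminus, hplus_eq, hminus_eq, hval1, hval2] at hmono
  have h1s : 0 < 1 - s := by linarith
  have hmono2 := mul_le_mul_of_nonneg_left hmono (by linarith : 0 ≤ (1 - s) / 2)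
  have e1 : const₁ n s L C * ε ^ (2 * s) = (1 - s) / 2 *
      (√Real.pi * Real.Gamma (((n : ℝ) - 1) / 2 + s) / Real.Gamma ((n : ℝ) / 2 + s) *
        ε ^ (2 * s) * (sphereArea (n - 1) * (mu₁ s L C / (1 - s)))) := by
    rw [const₁]
    field_simp
  rw [e1]
  linarith

end FracMA

end

/-! ### Positivity of `μ₁` and the lower bound `μ₀` on every line -/

noncomputable section

namespace FracMA

variable {n : ℕ} {s : ℝ} {u : E n → ℝ} {L : ℝ≥0} {C : ℝ}

theorem mu₁_nonneg (hs' : s < 1) (hC : 0 ≤ C) : 0 ≤ mu₁ s L C := by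
  rw [mu₁_eq]
  refine mul_nonneg (by linarith) (setIntegral_nonneg measurableSet_Ioi fun r hr => ?_)
  have hr' := mem_Ioi.1 hr
  have := modulus_nonneg L.coe_nonneg hC r
  positivity

theorem line_integral_le_mu₁ (hs : 1 / 2 < s) (hs' : s < 1) (hL : LipschitzWith L u)
    (hC : SemiconcaveOn univ C u) (x : E n) {e : E n} (he : ‖e‖ = 1)
    (hint : Integrable (fun t : ℝ => secondDiff u x (t • e) / |t| ^ (1 + 2 * s))) :
    (1 - s) / 2 * ∫ t : ℝ, secondDiff u x (t • e) / |t| ^ (1 + 2 * s) ≤ mu₁ s L C := by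
  refine mul_le_mul_of_nonneg_left (integral_mono hint
    (integrable_modulus L.coe_nonneg hC.2.1 hs hs') fun t => ?_) (by linarith)
  exact div_le_div_of_nonneg_right (secondDiff_smul_le hL hC x he t) (by positivity)

theorem const₁_factor_pos (hn : 2 ≤ n) (hs : 0 < s) :
    0 < √Real.pi * Real.Gamma (((n : ℝ) - 1) / 2 + s) / Real.Gamma ((n : ℝ) / 2 + s) := by
  have hn' : (2 : ℝ) ≤ n := by exact_mod_cast hn
  have h1 : 0 < Real.Gamma (((n : ℝ) - 1) / 2 + s) := Real.Gamma_pos_of_pos (by linarith)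
  have h2 : 0 < Real.Gamma ((n : ℝ) / 2 + s) := Real.Gamma_pos_of_pos (by linarith)
  have := Real.pi_pos
  positivity

theorem integral_kernel_one_le (hn : 1 ≤ n) (hs : 1 / 2 < s) (hs' : s < 1) (hL : LipschitzWith L u)
    (hC : SemiconcaveOn univ C u) (x : E n)
    (hint : Integrable fun y => secondDiff u x y * kernel s 1 y) :
    ∫ y, secondDiff u x y * kernel s 1 y ≤ sphereArea n * (mu₁ s L C / (1 - s)) := by
  have : Nonempty (Fin n) := ⟨⟨0, hn⟩⟩
  rw [← integral_modulus_norm (V := E n) L C hs' (d := n) (by simp)]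
  simp only [← kernel_one]
  exact integral_mono hint
    (integrable_modulus_kernel hn L.coe_nonneg hC.2.1 hs hs' (one_mem_unimodular n)) fun y =>
      mul_le_mul_of_nonneg_right (secondDiff_le_modulus hL hC x y) (kernel_nonneg s 1 y)

/-- If all the operators `L_A u (x)` are bounded below by a positive constant, then `μ₁` is
positive. -/
theorem mu₁_pos (hn : 2 ≤ n) (hs : 1 / 2 < s) (hs' : s < 1) (hL : LipschitzWith L u)
    (hC : SemiconcaveOn univ C u) (x : E n) {η₀ : ℝ} (hη₀ : 0 < η₀)
    (hA : ∀ A ∈ unimodular n, Integrable (fun y => secondDiff u x y * kernel s A y) ∧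
      η₀ ≤ (1 - s) / 2 * ∫ y, secondDiff u x y * kernel s A y) : 0 < mu₁ s L C := by
  refine (mu₁_nonneg hs' hC.2.1).lt_of_ne fun h0 => ?_
  obtain ⟨h1, h2⟩ := hA 1 (one_mem_unimodular n)
  have h3 := integral_kernel_one_le (by omega) hs hs' hL hC x h1
  rw [← h0, zero_div, mul_zero] at h3
  have := mul_le_mul_of_nonneg_left h3 (by linarith : 0 ≤ (1 - s) / 2)
  linarith

/-- All one-dimensional operators are bounded below by `μ₀`. -/
theorem mu₀_le_line_integral (hn : 2 ≤ n) (hs : 1 / 2 < s) (hs' : s < 1) (hL : LipschitzWith L u)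
    (hC : SemiconcaveOn univ C u) (x : E n) {η₀ : ℝ} (hη₀ : 0 < η₀)
    (hA : ∀ A ∈ unimodular n, Integrable (fun y => secondDiff u x y * kernel s A y) ∧
      η₀ ≤ (1 - s) / 2 * ∫ y, secondDiff u x y * kernel s A y) {e : E n} (he : ‖e‖ = 1) :
    Integrable (fun t : ℝ => secondDiff u x (t • e) / |t| ^ (1 + 2 * s)) ∧
      mu₀ n s L C η₀ ≤ (1 - s) / 2 * ∫ t : ℝ, secondDiff u x (t • e) / |t| ^ (1 + 2 * s) := by
  have hs0 : 0 < s := by linarith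
  have hμ₁ := mu₁_pos hn hs hs' hL hC x hη₀ hA
  have hω := sphereArea_pos (show 0 < n - 1 by omega)
  have hc₂ := const₂_pos hn hs0
  have hc₁ : 0 < const₁ n s L C := mul_pos (const₁_factor_pos hn hs0) (by positivity)
  set c₁ := const₁ n s L C with hc₁def
  -- Chosen so that the transversal error `c₁ ε^(2s)` is exactly `η₀ / 2`; the determinant condition
  -- then fixes `M`.
  set ε : ℝ := (η₀ / (2 * c₁)) ^ (1 / (2 * s)) with hεdef
  have hε : 0 < ε := by positivity
  have hε2 : ε ^ (2 * s) = η₀ / (2 * c₁) := by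
    rw [hεdef, ← Real.rpow_mul (by positivity), one_div, inv_mul_cancel₀ (by positivity),
      Real.rpow_one]
  set M : ℝ := (ε ^ (n - 1))⁻¹ with hMdef
  have hM : 0 < M := by positivity
  have hMε : M * ε ^ (n - 1) = 1 := inv_mul_cancel₀ (by positivity)
  have hM2 : M ^ (2 * s) = ((η₀ / (2 * c₁)) ^ (n - 1))⁻¹ := by
    rw [hMdef, Real.inv_rpow (by positivity), ← hε2, ← Real.rpow_natCast, ← Real.rpow_natCast,
      ← Real.rpow_mul hε.le, ← Real.rpow_mul hε.le, mul_comm]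
  obtain ⟨hi, hle⟩ := hA _ (stretch_mem_unimodular (by omega) he hM hε hMε)
  obtain ⟨h1, h2⟩ := integral_stretch_le hn hs hs' hL hC x he hM hε hMε hi
  refine ⟨h1, ?_⟩
  set J := (1 - s) / 2 * ∫ t : ℝ, secondDiff u x (t • e) / |t| ^ (1 + 2 * s)
  have h3 := hle.trans h2
  rw [hε2, hM2, ← hc₁def, show c₁ * (η₀ / (2 * c₁)) = η₀ / 2 by field_simp] at h3
  have h4 : η₀ / 2 ≤ const₂ n s * ((η₀ / (2 * c₁)) ^ (n - 1))⁻¹ * J := by linarith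
  have h5 : c₁ ^ (1 - (n : ℝ)) = (c₁ ^ (n - 1))⁻¹ := by
    rw [← Real.rpow_natCast, ← Real.rpow_neg hc₁.le, Nat.cast_sub (by omega)]
    congr 1
    push_cast
    ring
  have h6 : mu₀ n s L C η₀ =
      (η₀ / 2) / (const₂ n s * ((η₀ / (2 * c₁)) ^ (n - 1))⁻¹) := by
    rw [mu₀, ← hc₁def, h5, ← div_div η₀ 2 c₁, div_pow (η₀ / 2) c₁]
    obtain ⟨m, rfl⟩ : ∃ m, n = m + 1 := ⟨n - 1, by omega⟩
    rw [Nat.add_sub_cancel, pow_succ (η₀ / 2)]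
    field_simp
  rw [h6, div_le_iff₀ (by positivity), mul_comm J]
  exact h4

theorem mu₀_pos (hn : 2 ≤ n) (hs : 0 < s) {η₀ : ℝ} (hη₀ : 0 < η₀) (hμ₁ : 0 < mu₁ s L C) :
    0 < mu₀ n s L C η₀ := by
  have hω := sphereArea_pos (show 0 < n - 1 by omega)
  have hc₂ := const₂_pos hn hs
  have hc₁ : 0 < const₁ n s L C := mul_pos (const₁_factor_pos hn hs) (by positivity)
  unfold mu₀
  positivity

end FracMA

end

/-! ### Polar coordinates and second moments of the sphere -/

noncomputable section

namespace FracMA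

section Polar

variable {V : Type*} [NormedAddCommGroup V] [InnerProductSpace ℝ V] [FiniteDimensional ℝ V]
  [MeasurableSpace V] [BorelSpace V] [Nontrivial V]

/-- Integration in polar coordinates. -/
theorem integral_polar {f : V → ℝ} (hf : Integrable f) :
    Integrable (fun ω : Metric.sphere (0 : V) 1 =>
      ∫ r in Ioi (0 : ℝ), r ^ (Module.finrank ℝ V - 1) * f (r • (ω : V)))
      (volume : Measure V).toSphere ∧
    ∫ y, f y = ∫ ω : Metric.sphere (0 : V) 1,
      (∫ r in Ioi (0 : ℝ), r ^ (Module.finrank ℝ V - 1) * f (r • (ω : V)))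
      ∂(volume : Measure V).toSphere := by
  set g : Metric.sphere (0 : V) 1 × Ioi (0 : ℝ) → ℝ := fun z => f (z.2.1 • z.1.1) with hg
  have hmp := (volume : Measure V).measurePreserving_homeomorphUnitSphereProd
  have hemb := (homeomorphUnitSphereProd V).measurableEmbedding
  have hcomp : g ∘ homeomorphUnitSphereProd V = f ∘ Subtype.val := by
    funext y
    have hy : ‖(y : V)‖ ≠ 0 := norm_ne_zero_iff.2 y.2
    simp [hg, smul_smul, hy]
  have hint : Integrable g ((volume : Measure V).toSphere.prod
      (.volumeIoiPow (Module.finrank ℝ V - 1))) := by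
    rw [← hmp.integrable_comp_emb hemb, hcomp,
      ← integrableOn_iff_comap_subtypeVal (measurableSet_singleton _).compl]
    exact hf.integrableOn
  have hinner : ∀ ω : Metric.sphere (0 : V) 1,
      ∫ r, g (ω, r) ∂(Measure.volumeIoiPow (Module.finrank ℝ V - 1)) =
        ∫ r in Ioi (0 : ℝ), r ^ (Module.finrank ℝ V - 1) * f (r • (ω : V)) := by
    intro ω
    simp only [Measure.volumeIoiPow, ENNReal.ofReal, hg]
    rw [integral_withDensity_eq_integral_smul,
      integral_subtype_comap measurableSet_Ioi
        fun a => Real.toNNReal (a ^ (Module.finrank ℝ V - 1)) • f (a • (ω : V)),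
      setIntegral_congr_fun measurableSet_Ioi fun r hr => ?_]
    · rw [NNReal.smul_def, Real.coe_toNNReal _ (pow_nonneg (mem_Ioi.1 hr).le _), smul_eq_mul]
    · exact (measurable_subtype_coe.pow_const _).real_toNNReal
  have hleft := hint.integral_prod_left
  simp only [hinner] at hleft
  refine ⟨hleft, ?_⟩
  simp only [← hinner]
  rw [← integral_prod _ hint, ← hmp.integral_comp hemb]
  change _ = ∫ y, (g ∘ homeomorphUnitSphereProd V) y ∂_
  rw [hcomp]
  change _ = ∫ y : ({(0 : V)}ᶜ : Set V), f y.1 ∂_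
  rw [integral_subtype_comap (measurableSet_singleton _).compl f, restrict_compl_singleton]

/-- Exchanging two basis vectors shows that all these moments agree, and their sum is the area of
the sphere. -/
theorem integral_sphere_inner_sq {ι : Type*} [Fintype ι] (b : OrthonormalBasis ι ℝ V) (i : ι) :
    ∫ ω : Metric.sphere (0 : V) 1, inner ℝ (b i) (ω : V) ^ 2 ∂(volume : Measure V).toSphere =
      sphereArea (Module.finrank ℝ V) / Module.finrank ℝ V := by
  classical
  set d := Module.finrank ℝ V with hd
  have hd0 : 0 < d := Module.finrank_pos
  set σ := (volume : Measure V).toSphere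
  -- A Gaussian weight transfers the invariance of volume under linear isometries to the sphere: the
  -- radial factor `c` is common to all `j` and cancels.
  set f : ι → V → ℝ := fun j y => inner ℝ (b j) y ^ 2 * Real.exp (-‖y‖ ^ 2) with hf
  have hgauss : IntegrableOn (fun r : ℝ => r ^ ((d - 1 + 2 : ℕ) : ℝ) * Real.exp (-r ^ 2))
      (Ioi 0) := by
    have hm : (-1 : ℝ) < ((d - 1 + 2 : ℕ) : ℝ) := by
      have := Nat.cast_nonneg (α := ℝ) (d - 1 + 2)
      linarith
    simpa using integrableOn_rpow_mul_exp_neg_mul_rpow (p := 2) (s := ((d - 1 + 2 : ℕ) : ℝ))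
      hm two_pos one_pos
  have hcpos : 0 < ∫ r in Ioi (0 : ℝ), r ^ (d - 1 + 2) * Real.exp (-r ^ 2) := by
    have hm : (-1 : ℝ) < ((d - 1 + 2 : ℕ) : ℝ) := by
      have := Nat.cast_nonneg (α := ℝ) (d - 1 + 2)
      linarith
    have := integral_rpow_mul_exp_neg_mul_rpow (p := 2) (q := ((d - 1 + 2 : ℕ) : ℝ)) (b := 1)
      two_pos hm one_pos
    simp only [Real.rpow_natCast, Real.rpow_ofNat, neg_mul, one_mul, Real.one_rpow] at this
    rw [this]
    have h2 : 0 < Real.Gamma ((((d - 1 + 2 : ℕ) : ℝ) + 1) / 2) :=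
      Real.Gamma_pos_of_pos (by linarith)
    positivity
  set c := ∫ r in Ioi (0 : ℝ), r ^ (d - 1 + 2) * Real.exp (-r ^ 2)
  have hfint : ∀ j, Integrable (f j) := by
    intro j
    have h1 : Integrable fun y : V => ‖y‖ ^ 2 * Real.exp (-‖y‖ ^ 2) := by
      refine (integrable_fun_norm_addHaar (volume : Measure V)
        (f := fun r => r ^ 2 * Real.exp (-r ^ 2))).2 ?_
      simp only [Real.rpow_natCast] at hgauss
      simpa only [smul_eq_mul, ← mul_assoc, ← pow_add] using hgauss
    refine h1.mono' (by simp only [hf]; fun_prop) (ae_of_all _ fun y => ?_)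
    have h2 := abs_real_inner_le_norm (b j) y
    rw [b.norm_eq_one, one_mul] at h2
    simp only [hf]
    rw [Real.norm_of_nonneg (by positivity), ← sq_abs (inner ℝ (b j) y)]
    gcongr
  have hpolar : ∀ j, ∫ y, f j y = c * ∫ ω : Metric.sphere (0 : V) 1,
      inner ℝ (b j) (ω : V) ^ 2 ∂σ := by
    intro j
    rw [(integral_polar (hfint j)).2, ← integral_const_mul]
    refine integral_congr_ae (ae_of_all _ fun ω => ?_)
    have hω : ‖(ω : V)‖ = 1 := by simp
    change _ = (∫ r in Ioi (0 : ℝ), r ^ (d - 1 + 2) * Real.exp (-r ^ 2)) * _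
    rw [← integral_mul_const]
    refine setIntegral_congr_fun measurableSet_Ioi fun r hr => ?_
    simp only [hf, inner_smul_right, norm_smul, hω, mul_one, Real.norm_eq_abs, sq_abs, pow_add]
    ring
  have hsymm : ∀ j, ∫ y, f j y = ∫ y, f i y := by
    intro j
    set R := b.equiv b (Equiv.swap i j)
    have hR : ∀ y, inner ℝ (b j) (R y) = inner ℝ (b i) y := fun y => by
      rw [← R.inner_map_map (b i) y]
      simp [R]
    rw [← R.measurePreserving.integral_comp R.toHomeomorph.measurableEmbedding]
    simp only [hf, hR, R.norm_map]
  have heq : ∀ j, ∫ ω : Metric.sphere (0 : V) 1, inner ℝ (b j) (ω : V) ^ 2 ∂σ =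
      ∫ ω : Metric.sphere (0 : V) 1, inner ℝ (b i) (ω : V) ^ 2 ∂σ := by
    intro j
    have := hsymm j
    rw [hpolar, hpolar] at this
    exact mul_left_cancel₀ hcpos.ne' this
  have hsphint : ∀ j, Integrable (fun ω : Metric.sphere (0 : V) 1 =>
      inner ℝ (b j) (ω : V) ^ 2) σ := fun j =>
    Continuous.integrable_of_hasCompactSupport (by fun_prop) (HasCompactSupport.of_compactSpace _)
  have hsum : ∑ j, ∫ ω : Metric.sphere (0 : V) 1, inner ℝ (b j) (ω : V) ^ 2 ∂σ =
      sphereArea d := by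
    rw [← integral_finsetSum _ fun j _ => hsphint j]
    have h1 : ∀ ω : Metric.sphere (0 : V) 1, ∑ j, inner ℝ (b j) (ω : V) ^ 2 = 1 := fun ω => by
      have := b.sum_sq_norm_inner_right (ω : V)
      simpa using this
    simp only [h1, integral_const, smul_eq_mul, mul_one]
    rw [Measure.toSphere_real_apply_univ, finrank_mul_volume_unitBall]
  simp only [heq, Finset.sum_const, Finset.card_univ, nsmul_eq_mul] at hsum
  have hcard : (Fintype.card ι : ℝ) = d := by
    rw [hd, Module.finrank_eq_card_basis b.toBasis]
  rw [hcard] at hsum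
  rw [eq_div_iff (by positivity), mul_comm]
  exact hsum

end Polar

end FracMA

end

/-! ### Comparison with the identity matrix -/

noncomputable section

namespace FracMA

variable {n : ℕ} {s : ℝ} {u : E n → ℝ} {L : ℝ≥0} {C : ℝ}

theorem secondDiff_abs_smul (u : E n → ℝ) (x e : E n) (t : ℝ) :
    secondDiff u x (|t| • e) = secondDiff u x (t • e) := by
  rcases abs_choice t with h | h <;> rw [h]
  rw [neg_smul, secondDiff_neg]

/-- The one-dimensional operator is homogeneous of degree `2s` in the direction. -/
theorem halfline_integral_smul (u : E n → ℝ) (x e : E n) {ρ : ℝ} (hρ : 0 < ρ) :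
    ∫ r in Ioi (0 : ℝ), secondDiff u x (r • ρ • e) / r ^ (1 + 2 * s) =
      ρ ^ (2 * s) * (1 / 2 * ∫ t : ℝ, secondDiff u x (t • e) / |t| ^ (1 + 2 * s)) := by
  set g : ℝ → ℝ := fun r => secondDiff u x (r • e) / r ^ (1 + 2 * s) with hg
  have h1 := integral_comp_abs (f := g)
  simp only [hg, secondDiff_abs_smul] at h1
  have h2 := integral_comp_mul_left_Ioi g 0 hρ
  rw [mul_zero, smul_eq_mul] at h2
  have h3 : ∀ r ∈ Ioi (0 : ℝ), secondDiff u x (r • ρ • e) / r ^ (1 + 2 * s) =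
      ρ ^ (1 + 2 * s) * g (ρ * r) := by
    intro r hr
    have hr' := mem_Ioi.1 hr
    have h4 : 0 < ρ ^ (1 + 2 * s) := by positivity
    have h5 : 0 < r ^ (1 + 2 * s) := by positivity
    simp only [hg]
    rw [Real.mul_rpow hρ.le hr'.le, smul_smul, mul_comm r ρ]
    field_simp
  rw [setIntegral_congr_fun measurableSet_Ioi h3, integral_const_mul, h2, h1,
    Real.rpow_add hρ, Real.rpow_one]
  field_simp
  rfl

/-- If all the one-dimensional operators are bounded below by `m`, the operator `L_A` is bounded
below in terms of any eigenvalue of `A`. -/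
theorem le_integral_kernel (hn : 2 ≤ n) (hs : 1 / 2 < s) (hs' : s < 1)
    {A : Matrix (Fin n) (Fin n) ℝ} (hA : A.PosDef) (hdet : A.det = 1) (x : E n) {m : ℝ} (hm : 0 ≤ m)
    (hint : Integrable fun y => secondDiff u x y * kernel s A y)
    (hline : ∀ e : E n, ‖e‖ = 1 →
      m ≤ (1 - s) / 2 * ∫ t : ℝ, secondDiff u x (t • e) / |t| ^ (1 + 2 * s)) (i : Fin n) :
    hA.isHermitian.eigenvalues i ^ (2 * s) * (m / (1 - s)) * (sphereArea n / n) ≤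
      ∫ y, secondDiff u x y * kernel s A y := by
  have hu : A ∈ unimodular n := ⟨hA, hdet⟩
  have : Nonempty (Fin n) := ⟨i⟩
  have h1s : 0 < 1 - s := by linarith
  set T := Matrix.toEuclideanCLM (𝕜 := ℝ) A with hT
  -- The volume-preserving substitution by `A` makes the kernel isotropic and moves the anisotropy
  -- into the increment.
  set f : E n → ℝ := fun y => secondDiff u x (T y) * kernel s 1 y with hf
  have hcomp : (fun y : E n => secondDiff u x y * kernel s A y) ∘ T = f := by
    funext y
    simp only [Function.comp_apply, hf, hT, kernel_clm hu]
  have hfint : Integrable f := by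
    rw [← hcomp]
    exact ((measurePreserving hu).integrable_comp_emb (measurableEmbedding hu)).2 hint
  have hfeq : ∫ y, f y = ∫ y, secondDiff u x y * kernel s A y := by
    rw [← hcomp]
    exact (measurePreserving hu).integral_comp (measurableEmbedding hu)
      (fun y => secondDiff u x y * kernel s A y)
  obtain ⟨hp1, hp2⟩ := integral_polar hfint
  have hdim : Module.finrank ℝ (E n) = n := finrank_euclideanSpace_fin
  rw [← hfeq, hp2]
  set b := hA.isHermitian.eigenvectorBasis
  have hsph := integral_sphere_inner_sq b i
  rw [hdim] at hsph
  rw [← hsph, ← integral_const_mul]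
  refine integral_mono (Continuous.integrable_of_hasCompactSupport (by fun_prop)
    (HasCompactSupport.of_compactSpace _)) hp1 fun ω => ?_
  have hω : ‖(ω : E n)‖ = 1 := by simp
  have hTω : 0 < ‖T ω‖ := norm_pos_iff.2 (clm_ne_zero hu (norm_ne_zero_iff.1 (by rw [hω]; simp)))
  -- The ray through `ω` is sent to the ray through `Tω`; normalizing its direction extracts the
  -- factor `‖Tω‖^(2s)` by homogeneity.
  have hinner : ∫ r in Ioi (0 : ℝ), r ^ (Module.finrank ℝ (E n) - 1) * f (r • (ω : E n)) =
      ∫ r in Ioi (0 : ℝ), secondDiff u x (r • ‖T ω‖ • (‖T ω‖⁻¹ • T ω)) / r ^ (1 + 2 * s) := by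
    refine setIntegral_congr_fun measurableSet_Ioi fun r hr => ?_
    have hr' := mem_Ioi.1 hr
    simp only [hf]
    rw [kernel_one, norm_smul, hω, mul_one, Real.norm_of_nonneg hr'.le, hdim,
      pow_mul_div_rpow (by omega) hr', map_smul, smul_inv_smul₀ hTω.ne']
  dsimp only
  rw [hinner, halfline_integral_smul _ _ _ hTω]
  have hl := hline (‖T ω‖⁻¹ • T ω) (by rw [norm_smul, norm_inv, norm_norm, inv_mul_cancel₀ hTω.ne'])
  set J := ∫ t : ℝ, secondDiff u x (t • (‖T ω‖⁻¹ • T ω)) / |t| ^ (1 + 2 * s)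
  have hJ : m / (1 - s) ≤ 1 / 2 * J := by
    rw [div_le_iff₀ h1s]
    linarith
  have hb := eigenvalue_mul_abs_inner_le hA i (ω : E n)
  have hpos := hA.eigenvalues_pos i
  have hb1 : |inner ℝ (b i) (ω : E n)| ≤ 1 := by
    have := abs_real_inner_le_norm (b i) (ω : E n)
    rwa [b.norm_eq_one, hω, one_mul] at this
  -- Lowering the exponent from `2` to `2s` increases a number in `[0,1]`; this replaces the moment
  -- of order `2s` by the explicit second moment.
  have hsq : inner ℝ (b i) (ω : E n) ^ 2 ≤ |inner ℝ (b i) (ω : E n)| ^ (2 * s) := by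
    rw [← sq_abs, ← Real.rpow_natCast]
    rcases (abs_nonneg (inner ℝ (b i) (ω : E n))).eq_or_lt with h0 | h0
    · rw [← h0, Real.zero_rpow (by norm_num), Real.zero_rpow (by linarith)]
    · exact Real.rpow_le_rpow_of_exponent_ge h0 hb1 (by push_cast; linarith)
  have hpow : hA.isHermitian.eigenvalues i ^ (2 * s) * inner ℝ (b i) (ω : E n) ^ 2 ≤
      ‖T ω‖ ^ (2 * s) := by
    refine le_trans (mul_le_mul_of_nonneg_left hsq (by positivity)) ?_
    rw [← Real.mul_rpow hpos.le (abs_nonneg _)]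
    exact Real.rpow_le_rpow (by positivity) hb (by linarith)
  calc hA.isHermitian.eigenvalues i ^ (2 * s) * (m / (1 - s)) * inner ℝ (b i) (ω : E n) ^ 2
      = (hA.isHermitian.eigenvalues i ^ (2 * s) * inner ℝ (b i) (ω : E n) ^ 2) * (m / (1 - s)) := by
        ring
    _ ≤ ‖T ω‖ ^ (2 * s) * (1 / 2 * J) := mul_le_mul hpow hJ (by positivity) (by positivity)

theorem threshold_pos (hn : 2 ≤ n) (hs : 0 < s) {η₀ : ℝ} (hη₀ : 0 < η₀) (hμ₁ : 0 < mu₁ s L C) :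
    0 < threshold n s L C η₀ := by
  have := mu₀_pos hn hs hη₀ hμ₁
  unfold threshold
  positivity

theorem one_mem_unimodularGE {θ : ℝ} (hθ : θ ≤ 1) :
    (1 : Matrix (Fin n) (Fin n) ℝ) ∈ unimodularGE n θ := by
  refine ⟨Matrix.PosDef.one, Matrix.det_one, fun i => ?_⟩
  set h := (Matrix.PosDef.one : (1 : Matrix (Fin n) (Fin n) ℝ).PosDef).isHermitian
  have h1 := inner_clm_eigenvectorBasis h i (h.eigenvectorBasis i)
  rw [map_one, one_apply_eq_self, real_inner_self_eq_norm_sq, OrthonormalBasis.norm_eq_one] at h1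
  linarith

/-- Matrices with a small eigenvalue give a larger value than the identity. -/
theorem integral_kernel_one_le_of_eigenvalue_le (hn : 2 ≤ n) (hs : 1 / 2 < s) (hs' : s < 1)
    (hL : LipschitzWith L u) (hC : SemiconcaveOn univ C u) (x : E n) {η₀ : ℝ} (hη₀ : 0 < η₀)
    (hall : ∀ A ∈ unimodular n, Integrable (fun y => secondDiff u x y * kernel s A y) ∧
      η₀ ≤ (1 - s) / 2 * ∫ y, secondDiff u x y * kernel s A y)
    {A : Matrix (Fin n) (Fin n) ℝ} (hA : A.PosDef) (hdet : A.det = 1) {i : Fin n}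
    (hi : hA.isHermitian.eigenvalues i ≤ threshold n s L C η₀) :
    ∫ y, secondDiff u x y * kernel s 1 y ≤ ∫ y, secondDiff u x y * kernel s A y := by
  have hs0 : 0 < s := by linarith
  have h1s : 0 < 1 - s := by linarith
  have hn' : (2 : ℝ) ≤ n := by exact_mod_cast hn
  have hμ₁ := mu₁_pos hn hs hs' hL hC x hη₀ hall
  have hμ₀ := mu₀_pos hn hs0 hη₀ hμ₁
  have hω := sphereArea_pos (show 0 < n by omega)
  have hpos := hA.eigenvalues_pos i
  obtain ⟨j, hj⟩ := exists_rpow_le_eigenvalue hn hA hdet i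
  have hlow := le_integral_kernel hn hs hs' hA hdet x hμ₀.le (hall A ⟨hA, hdet⟩).1
    (fun e he => (mu₀_le_line_integral hn hs hs' hL hC x hη₀ hall he).2) j
  refine (integral_kernel_one_le (by omega) hs hs' hL hC x
    (hall 1 (one_mem_unimodular n)).1).trans (le_trans ?_ hlow)
  set q := mu₀ n s L C η₀ / (n * mu₁ s L C) with hq
  have hqpos : 0 < q := by positivity
  have h1 : q⁻¹ ≤ hA.isHermitian.eigenvalues j ^ (2 * s) := by
    -- The exponent `(n-1)/(2s)` in the threshold is the one that undoes both the passage to a large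
    -- eigenvalue and the power `2s`.
    have h2 : q⁻¹ = (threshold n s L C η₀ ^ (-(1 / ((n : ℝ) - 1)))) ^ (2 * s) := by
      rw [threshold, ← hq, ← Real.rpow_mul hqpos.le, ← Real.rpow_mul hqpos.le, ← Real.rpow_neg_one]
      congr 1
      have : (n : ℝ) - 1 ≠ 0 := by linarith
      field_simp
    rw [h2]
    refine Real.rpow_le_rpow (by have := threshold_pos hn hs0 hη₀ hμ₁; positivity)
      (le_trans ?_ hj) (by positivity)
    refine Real.rpow_le_rpow_of_nonpos hpos hi (neg_nonpos.2 ?_)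
    exact div_nonneg zero_le_one (by linarith)
  calc sphereArea n * (mu₁ s L C / (1 - s))
      = q⁻¹ * (mu₀ n s L C η₀ / (1 - s)) * (sphereArea n / n) := by
        rw [hq]
        field_simp
    _ ≤ _ := by gcongr

/-- On any line `μ₀ ≤ J(e) ≤ μ₁`, so the base of the threshold is at most `1/n`. This is what admits
the identity in the restricted infimum. -/
theorem threshold_le_one (hn : 2 ≤ n) (hs : 1 / 2 < s) (hs' : s < 1)
    (hL : LipschitzWith L u) (hC : SemiconcaveOn univ C u) (x : E n) {η₀ : ℝ} (hη₀ : 0 < η₀)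
    (hall : ∀ A ∈ unimodular n, Integrable (fun y => secondDiff u x y * kernel s A y) ∧
      η₀ ≤ (1 - s) / 2 * ∫ y, secondDiff u x y * kernel s A y) :
    threshold n s L C η₀ ≤ 1 := by
  have hs0 : 0 < s := by linarith
  have hn' : (2 : ℝ) ≤ n := by exact_mod_cast hn
  have hμ₁ := mu₁_pos hn hs hs' hL hC x hη₀ hall
  have hμ₀ := mu₀_pos hn hs0 hη₀ hμ₁
  have he : ‖EuclideanSpace.single (⟨0, by omega⟩ : Fin n) (1 : ℝ)‖ = 1 := by simp
  obtain ⟨h1, h2⟩ := mu₀_le_line_integral hn hs hs' hL hC x hη₀ hall he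
  have h3 := h2.trans (line_integral_le_mu₁ hs hs' hL hC x he h1)
  refine Real.rpow_le_one (by positivity) ?_ (div_nonneg (by linarith) (by linarith))
  rw [div_le_one (by positivity)]
  nlinarith

/-- A matrix with all eigenvalues at least `θ` already competes; any other has an eigenvalue below
the threshold and is beaten by the identity. -/
theorem maOpGE_eq_maOp (hn : 2 ≤ n) (hs : 1 / 2 < s) (hs' : s < 1)
    (hL : LipschitzWith L u) (hC : SemiconcaveOn univ C u) (x : E n) {η₀ : ℝ} (hη₀ : 0 < η₀)
    (hall : ∀ A ∈ unimodular n, Integrable (fun y => secondDiff u x y * kernel s A y) ∧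
      η₀ ≤ (1 - s) / 2 * ∫ y, secondDiff u x y * kernel s A y) {θ : ℝ}
    (hθ : θ < threshold n s L C η₀) : maOpGE s θ u x = maOp s u x := by
  refine le_antisymm (le_iInf₂ fun A hA => ?_) (le_iInf₂ fun A hA => ?_)
  · by_cases h : ∀ i, θ ≤ hA.1.isHermitian.eigenvalues i
    · exact iInf₂_le A ⟨hA.1, hA.2, h⟩
    · push Not at h
      obtain ⟨i, hi⟩ := h
      have hone := threshold_le_one hn hs hs' hL hC x hη₀ hall
      refine (iInf₂_le 1 (one_mem_unimodularGE (hθ.le.trans hone))).trans ?_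
      rw [linOp_eq_integral (hall 1 (one_mem_unimodular n)).1, linOp_eq_integral (hall A hA).1,
        EReal.coe_le_coe_iff]
      exact mul_le_mul_of_nonneg_left (integral_kernel_one_le_of_eigenvalue_le hn hs hs' hL hC x
        hη₀ hall hA.1 hA.2 (hi.trans hθ).le) (by norm_num)
  · obtain ⟨hpd, hdet, -⟩ := hA
    exact iInf₂_le A ⟨hpd, hdet⟩

theorem exists_coe_eq_maOp {x : E n} {η₀ : ℝ} (hs' : s < 1)
    (hall : ∀ A ∈ unimodular n, Integrable (fun y => secondDiff u x y * kernel s A y) ∧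
      η₀ ≤ (1 - s) / 2 * ∫ y, secondDiff u x y * kernel s A y) :
    ∃ d : ℝ, maOp s u x = (d : EReal) := by
  have htop : maOp s u x ≠ ⊤ := by
    refine ne_top_of_le_ne_top ?_ (iInf₂_le 1 (one_mem_unimodular n))
    rw [linOp_eq_integral (hall 1 (one_mem_unimodular n)).1]
    exact EReal.coe_ne_top _
  have hbot : maOp s u x ≠ ⊥ := by
    have h : ((η₀ / (1 - s) : ℝ) : EReal) ≤ maOp s u x := by
      refine le_iInf₂ fun A hA => ?_
      obtain ⟨h1, h2⟩ := hall A hA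
      rw [linOp_eq_integral h1, EReal.coe_le_coe_iff, div_le_iff₀ (by linarith)]
      linarith
    exact ne_bot_of_le_ne_bot (EReal.coe_ne_bot _) h
  exact ⟨(maOp s u x).toReal, (EReal.coe_toReal htop hbot).symm⟩

end FracMA

end

theorem theorem3p1 (n : ℕ) (hn : 2 ≤ n) (s : ℝ) (hs : 1 / 2 < s) (hs' : s < 1)
    (L : ℝ≥0) (C η₀ : ℝ) (hη₀ : 0 < η₀) (u : FracMA.E n → ℝ)
    (hL : LipschitzWith L u) (hC : FracMA.SemiconcaveOn univ C u)
    (Ω : Set (FracMA.E n)) (hΩ : IsOpen Ω)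
    (hu : FracMA.IsViscositySubsolution s Ω u (fun _ => η₀ / (1 - s))) :
    -- equality in the classical sense: all integrals converge and the common value is finite
    (∀ x ∈ Ω,
      (∀ A ∈ FracMA.unimodular n,
        Integrable (fun y : FracMA.E n =>
          FracMA.secondDiff u x y * FracMA.kernel s A y)) ∧
      ∃ d : ℝ, FracMA.maOp s u x = (d : EReal) ∧
        ∀ θ : ℝ, θ < FracMA.threshold n s L C η₀ →
          FracMA.maOpGE s θ u x = (d : EReal)) ∧
    -- uniform ellipticity: positive `θ` are allowed, and the kernels defining the operator
    -- with parameter `θ` are comparable to that of the fractional Laplacian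
    (Ω.Nonempty → 0 < FracMA.threshold n s L C η₀) ∧
    (∀ θ : ℝ, 0 < θ → θ < FracMA.threshold n s L C η₀ →
      ∀ A ∈ FracMA.unimodularGE n θ, ∀ y : FracMA.E n, y ≠ 0 →
        θ ^ ((n : ℝ) + 2 * s) / ‖y‖ ^ ((n : ℝ) + 2 * s) ≤ FracMA.kernel s A y ∧
        FracMA.kernel s A y ≤
          (θ ^ (1 - (n : ℝ))) ^ ((n : ℝ) + 2 * s) / ‖y‖ ^ ((n : ℝ) + 2 * s)) := by
  -- The factor `1 - s` is moved from the right side of the viscosity inequality onto the integral.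
  have hsub : ∀ x ∈ Ω, ∀ A ∈ FracMA.unimodular n,
      Integrable (fun y => FracMA.secondDiff u x y * FracMA.kernel s A y) ∧
        η₀ ≤ (1 - s) / 2 * ∫ y, FracMA.secondDiff u x y * FracMA.kernel s A y := by
    intro x hx A hA
    have h1s : 0 < 1 - s := by linarith
    obtain ⟨h1, h2⟩ := hu.integrable_and_le (by omega) hs hs' hL hC hΩ (by positivity) hx hA
    rw [div_le_iff₀ h1s] at h2
    exact ⟨h1, by linarith⟩
  refine ⟨fun x hx => ⟨fun A hA => (hsub x hx A hA).1, ?_⟩, ?_, ?_⟩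
  · obtain ⟨d, hd⟩ := FracMA.exists_coe_eq_maOp hs' (hsub x hx)
    exact ⟨d, hd, fun θ hθ =>
      (FracMA.maOpGE_eq_maOp hn hs hs' hL hC x hη₀ (hsub x hx) hθ).trans hd⟩
  · rintro ⟨x, hx⟩
    exact FracMA.threshold_pos hn (by linarith) hη₀
      (FracMA.mu₁_pos hn hs hs' hL hC x hη₀ (hsub x hx))
  · intro θ hθ _ A hA y hy
    exact FracMA.kernel_comparable (by linarith) hθ hA hy
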